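/- Let $k\ge 2$ be an integer, $a=\frac{k+1}{k+2}$, $h_\sigma=\frac{k-1}{4(k+2)}$, $\mathcal N>0$, and $N_1=\mathcal N\sin\frac{\pi}{k+2}$, $N_2=\mathcal N\sin\frac{3\pi}{k+2}$. For $0<x<1$ let \[ \mathcal F_1(x)=\sqrt{N_1}\,[x(1-x)]^{a/2}\int_0^x [w(x-w)(1-w)]^{-a}\,dw,\qquad \mathcal F_2(x)=\sqrt{N_2}\,[x(1-x)]^{a/2}\int_1^\infty [w(w-x)(w-1)]^{-a}\,dw \] be the two Coulomb-gas conformal blocks of $\langle\sigma\sigma\sigma\sigma\rangle$, $\sigma=\Phi_{(1,2)}$, in the minimal model $\mathcal M(k+2,k+1)$. For real $\eta=(\eta_1,\eta_2,\eta_3,\eta_4)$ whose anharmonic ratio $x=\frac{\eta_{12}\eta_{34}}{\eta_{13}\eta_{24}}$ (with $\eta_{ij}=\eta_i-\eta_j$) is in $(0,1)$, let $\mathcal F_\mu(\eta)=|\eta_{13}\eta_{24}|^{-2h_\sigma}\mathcal F_\mu(x)$. Put \[ R_{13}=\begin{pmatrix}\cos\theta_k&\sin\theta_k\\ \sin\theta_k&-\cos\theta_k\end{pmatrix},\qquad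 R_{12}=\begin{pmatrix}e^{-i\pi\frac{k-1}{2(k+2)}}&0\\0&e^{i\pi\frac{k+1}{2(k+2)}}\end{pmatrix}, \] where $\theta_k\in(0,\frac{\pi}{2})$ is the angle with $\cos\theta_k=\frac12\sec\frac{\pi}{k+2}$ (it exists). Then: (1) The two integrals converge absolutely for $0<x<1$, and $\mathcal F_1,\mathcal F_2$ are linearly independent over $\mathbb C$ as functions on $(0,1)$. (2) $R_{13}$ is real symmetric with $R_{13}^2=1$, and it is the matrix of the exchange $\eta_1\leftrightarrow\eta_3$, that is, of $x\to 1-x$: for $0<x<1$, $\mathcal F_\mu(1-x)=\sum_\nu (R_{13})_{\mu\nu}\mathcal F_\nu(x)$, and for $\eta_1<\eta_2<\eta_3<\eta_4$, $\mathcal F_\mu(\eta_3,\eta_2,\eta_1,\eta_4)=\sum_\nu (R_{13})_{\mu\nu}\mathcal F_\nu(\eta_1,\eta_2,\eta_3,\eta_4)$. (3) $R_{12}$ is the matrix of the braiding of $\eta_1,\eta_2$: for $\eta_1<\eta_2<\eta_3<\eta_4$, the germ at $\eta$ of $\mathcal F_\mu$ continues holomorphically along the path on which $\eta_1,\eta_2$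 make a counterclockwise half-turn about their midpoint, $\eta_3,\eta_4$ being fixed, and the resulting germ $\mathcal F'_\mu$ at the exchanged positions satisfies $\mathcal F'_\mu(y_2,y_1,y_3,y_4)=\sum_\nu (R_{12})_{\mu\nu}\mathcal F_\nu(y_1,y_2,y_3,y_4)$ for real $y$ near $\eta$. (4) In the same sense, the matrix of the braiding of $\eta_2,\eta_3$ is \[ R_{23}=R_{13}R_{12}R_{13}^{-1}=\begin{pmatrix} e^{i\pi\frac{k-1}{2(k+2)}}\cos\theta_k & e^{-i\pi\frac{k+1}{2(k+2)}}\sin\theta_k\\ e^{-i\pi\frac{k+1}{2(k+2)}}\sin\theta_k & -e^{-i\pi\frac{3k+1}{2(k+2)}}\cos\theta_k\end{pmatrix}. \] (5) For $k=3$ these reduce to the Fibonacci matrices: with $\gamma=\frac{1+\sqrt5}{2}$, \[ R_{12}=\begin{pmatrix}e^{-i\pi/5}&0\\0&e^{2\pi i/5}\end{pmatrix},\qquad R_{13}=\begin{pmatrix}\frac1\gamma&\frac1{\sqrt\gamma}\\ \frac1{\sqrt\gamma}&-\frac1\gamma\end{pmatrix}. \] -/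

import Mathlib

open MeasureTheory Set Filter Topology

noncomputable section

namespace CoulombGas

/-- The exponent `(k+1)/(k+2)` of the screened Coulomb-gas integrand. -/
def expo (k : ℕ) : ℝ := ((k : ℝ) + 1) / ((k : ℝ) + 2)

/-- The conformal dimension `h_σ = (k-1)/(4(k+2))` of `σ = Φ_{(1,2)}` in `M(k+2,k+1)`. -/
def hSigma (k : ℕ) : ℝ := ((k : ℝ) - 1) / (4 * ((k : ℝ) + 2))

/-- The integrand of the first block, on `0 < w < x`. -/
def integrand₁ (k : ℕ) (x w : ℝ) : ℝ := (w * (x - w) * (1 - w)) ^ (-expo k)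

/-- The integrand of the second block, on `1 < w`. -/
def integrand₂ (k : ℕ) (x w : ℝ) : ℝ := (w * (w - x) * (w - 1)) ^ (-expo k)

/-- The normalization constants `N₁ = C sin(π/(k+2))`, `N₂ = C sin(3π/(k+2))`. -/
def normConst (k : ℕ) (C : ℝ) : Fin 2 → ℝ :=
  ![C * Real.sin (Real.pi / ((k : ℝ) + 2)), C * Real.sin (3 * Real.pi / ((k : ℝ) + 2))]

/-- The two contour integrals, over `(0, x)` and over `(1, ∞)`. -/
def contourIntegral (k : ℕ) (x : ℝ) : Fin 2 → ℝ :=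
  ![∫ w in Ioo 0 x, integrand₁ k x w, ∫ w in Ioi 1, integrand₂ k x w]

/-- The conformal blocks of `⟨σ(0) σ(x) σ(1) σ(∞)⟩`, for `0 < x < 1`. Index `0` is the channel of
the identity, index `1` the channel of `ε`. -/
def block (k : ℕ) (C : ℝ) (μ : Fin 2) (x : ℝ) : ℝ :=
  √(normConst k C μ) * (x * (1 - x)) ^ (expo k / 2) * contourIntegral k x μ

/-- The anharmonic ratio `x = η₁₂ η₃₄ / (η₁₃ η₂₄)`. -/
def crossRatio (η : Fin 4 → ℝ) : ℝ :=
  ((η 0 - η 1) * (η 2 - η 3)) / ((η 0 - η 2) * (η 1 - η 3))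

/-- The conformal blocks of `⟨σ(η₁) σ(η₂) σ(η₃) σ(η₄)⟩` at real positions whose anharmonic ratio
is in `(0, 1)`: the Möbius-covariant function of weight `h_σ` in each position which, multiplied
by `|η₄| ^ (2 h_σ)`, tends to `block k C μ x` at `(0, x, 1, ∞)`. -/
def fullBlock (k : ℕ) (C : ℝ) (μ : Fin 2) (η : Fin 4 → ℝ) : ℝ :=
  |(η 0 - η 2) * (η 1 - η 3)| ^ (-(2 * hSigma k)) * block k C μ (crossRatio η)

/-- The counterclockwise half-turn of the positions `i` and `j` about their midpoint, the other
positions being fixed. At time `0` it is at `η`, at time `1` at `η` with `η i`, `η j` exchanged. -/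
def halfTwist (i j : Fin 4) (η : Fin 4 → ℝ) (t : ℝ) : Fin 4 → ℂ := fun l =>
  if l = i ∨ l = j then
    ((η i : ℂ) + η j) / 2 +
      Complex.exp (Complex.I * Real.pi * t) * ((η l : ℂ) - ((η i : ℂ) + η j) / 2)
  else (η l : ℂ)

/-- `φ` is a continuation along the path `γ`, over the time interval `[0, 1]`, of the germ at `η`
of the real function `f`, as a family of germs of holomorphic functions of four variables. -/
structure IsContinuation (f : (Fin 4 → ℝ) → ℝ) (η : Fin 4 → ℝ) (γ : ℝ → Fin 4 → ℂ)
    (φ : ℝ → (Fin 4 → ℂ) → ℂ) : Prop where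
  start : ∀ᶠ y in 𝓝 η, φ 0 (fun l => (y l : ℂ)) = (f y : ℂ)
  analytic : ∀ t ∈ Icc (0 : ℝ) 1, AnalyticAt ℂ (φ t) (γ t)
  compatible : ∀ t ∈ Icc (0 : ℝ) 1, ∀ᶠ s in 𝓝[Icc 0 1] t, φ s =ᶠ[𝓝 (γ s)] φ t

/-- `R` is the braiding matrix of the positions `i`, `j`: continued along the half-turn of `i`
and `j`, the blocks `F_μ` become, at the exchanged positions, `∑ ν, R μ ν * F_ν`. -/
def IsBraidingMatrix (k : ℕ) (C : ℝ) (i j : Fin 4) (R : Matrix (Fin 2) (Fin 2) ℂ) : Prop :=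
  ∀ η : Fin 4 → ℝ, StrictMono η → ∀ μ : Fin 2,
    ∃ φ : ℝ → (Fin 4 → ℂ) → ℂ,
      IsContinuation (fullBlock k C μ) η (halfTwist i j η) φ ∧
      ∀ᶠ y in 𝓝 η, φ 1 (fun l => (y (Equiv.swap i j l) : ℂ)) =
        ∑ ν, R μ ν * (fullBlock k C ν y : ℂ)

/-- The angle in `[0, π]` whose cosine is `½ sec(π/(k+2))`. -/
def theta (k : ℕ) : ℝ := Real.arccos (1 / 2 * (Real.cos (Real.pi / ((k : ℝ) + 2)))⁻¹)

def R13 (k : ℕ) : Matrix (Fin 2) (Fin 2) ℝ :=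
  !![Real.cos (theta k), Real.sin (theta k); Real.sin (theta k), -Real.cos (theta k)]

/-- The phase `e^{iα}` of a real angle `α`. -/
def phase (α : ℝ) : ℂ := Complex.exp (Complex.I * α)

def R12 (k : ℕ) : Matrix (Fin 2) (Fin 2) ℂ :=
  !![phase (-(Real.pi * (((k : ℝ) - 1) / (2 * ((k : ℝ) + 2))))), 0;
     0, phase (Real.pi * (((k : ℝ) + 1) / (2 * ((k : ℝ) + 2))))]

def R23 (k : ℕ) : Matrix (Fin 2) (Fin 2) ℂ :=
  !![phase (Real.pi * (((k : ℝ) - 1) / (2 * ((k : ℝ) + 2)))) * Real.cos (theta k),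
     phase (-(Real.pi * (((k : ℝ) + 1) / (2 * ((k : ℝ) + 2))))) * Real.sin (theta k);
     phase (-(Real.pi * (((k : ℝ) + 1) / (2 * ((k : ℝ) + 2))))) * Real.sin (theta k),
     -(phase (-(Real.pi * ((3 * (k : ℝ) + 1) / (2 * ((k : ℝ) + 2))))) * Real.cos (theta k))]

/-- The real matrix `R13 k`, with complex entries. -/
def R13C (k : ℕ) : Matrix (Fin 2) (Fin 2) ℂ := (R13 k).map Complex.ofReal

end CoulombGas

end

/-! Both blocks integrate one multivalued function, [w(w-x)(w-1)]^(-a), over intervals between its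
branch points. Write α = π/(k+2), so that πa = π - α.

Exchange x → 1-x. The boundary value of this function from the upper half-plane integrates to zero
over ℝ. Its phase is constant on each of the four intervals cut out by 0, x, 1; multiplying by
e^(3πia) and taking imaginary parts removes (-∞,0) and leaves a real relation between the other
three integrals (`contour_relation`). The reflection w → 1-w turns the integral over (x,1) into the
first contour integral at 1-x, so this relation is the first row of the exchange matrix, and the
ratio of the normalization constants makes that row (cos θ, sin θ). The second row follows because
the exchange is an involution (`block_one_sub`).

Braiding of the first two positions. Let P and Q be the numerator and the denominator of the
anharmonic ratio. Each block is a constant times P^p Q^q (1-x)^r G(x), where P and Q are taken up to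
a common sign and G is an Euler integral, holomorphic as long as 1-x avoids (-∞,0]. Along the
half-turn P just acquires the factor e^(iπt), while Q (up to that sign) and 1-x stay in the slit
plane (`path_mem_slitPlane`). At the end x has become x/(x-1), and the Pfaff transformations of G
(`eulerReal_beta_pfaff`, `eulerReal_tail_pfaff`) cancel everything except e^(iπp)
(`twistedBranch_one_swap`). The exponents p = -2h_σ and p = a/2 give the diagonal of `R12`.

Braiding of the second and third positions. Relabelling the first and third positions, which acts by
`R13`, reduces it to the previous case, so its matrix is a conjugate of `R12`
(`isBraidingMatrix_conj`).

Independence: the ratio of the first block to the second grows like x^(1-2a) as x → 0, and 2a > 1.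
-/

namespace CoulombGas

/-! ### Analyticity of Euler-type integrals -/

/-- The Euler-type integral `∫ ρ(w) (1 - x τ(w))^(-a)`, for complex `x`. -/
noncomputable def eulerIntegral (μ : Measure ℝ) (ρ τ : ℝ → ℝ) (a : ℝ) (x : ℂ) : ℂ :=
  ∫ w, (ρ w : ℂ) * (1 - x * τ w) ^ ((-a : ℝ) : ℂ) ∂μ

/-- The point lies on the segment from 1 to 1 - x, and the slit plane is star-shaped about 1. -/
theorem one_sub_mul_mem_slitPlane {x : ℂ} (hx : 1 - x ∈ Complex.slitPlane) {t : ℝ}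
    (ht : t ∈ Icc (0 : ℝ) 1) : 1 - x * t ∈ Complex.slitPlane := by
  have := Complex.starConvex_one_slitPlane hx (a := 1 - t) (b := t) (by linarith [ht.2]) ht.1
    (by ring)
  convert this using 1
  simp only [Complex.real_smul]; push_cast; ring

theorem isOpen_one_sub_mem_slitPlane : IsOpen {x : ℂ | 1 - x ∈ Complex.slitPlane} :=
  Complex.isOpen_slitPlane.preimage (by fun_prop)

/-- Differentiation under the integral sign: since τ takes values in [0,1], compactness of a closed
ball times [0,1] bounds the power and its derivative uniformly in w, so `ρ` alone carries the
integrability. -/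
theorem differentiableOn_eulerIntegral {μ : Measure ℝ} {ρ τ : ℝ → ℝ} (a : ℝ)
    (hρ : Integrable ρ μ) (hτ : Measurable τ) (hτ01 : ∀ᵐ w ∂μ, τ w ∈ Icc (0 : ℝ) 1) :
    DifferentiableOn ℂ (eulerIntegral μ ρ τ a) {x | 1 - x ∈ Complex.slitPlane} := by
  intro x₀ hx₀
  obtain ⟨δ, hδ, hball⟩ := Metric.nhds_basis_closedBall.mem_iff.1
    (isOpen_one_sub_mem_slitPlane.mem_nhds hx₀)
  have hcont : ∀ c : ℂ, ContinuousOn (fun p : ℂ × ℝ => (1 - p.1 * p.2) ^ c)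
      (Metric.closedBall x₀ δ ×ˢ Icc 0 1) := fun c p hp =>
    (ContinuousAt.cpow (f := fun p : ℂ × ℝ => 1 - p.1 * (p.2 : ℂ)) (by fun_prop)
      continuousAt_const
      (one_sub_mul_mem_slitPlane (hball hp.1) hp.2)).continuousWithinAt
  have hK : IsCompact (Metric.closedBall x₀ δ ×ˢ Icc (0 : ℝ) 1) :=
    (isCompact_closedBall _ _).prod isCompact_Icc
  obtain ⟨M, hM⟩ := hK.exists_bound_of_continuousOn (hcont ((-a : ℝ) : ℂ))
  obtain ⟨M', hM'⟩ := hK.exists_bound_of_continuousOn (hcont (((-a : ℝ) : ℂ) - 1))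
  have hmeas : ∀ (x c : ℂ), AEStronglyMeasurable (fun w => (1 - x * (τ w : ℂ)) ^ c) μ :=
    fun x c => by
      apply Measurable.aestronglyMeasurable
      fun_prop
  have hρC : Integrable (fun w => (ρ w : ℂ)) μ := hρ.ofReal
  have hmem : x₀ ∈ Metric.closedBall x₀ δ := Metric.mem_closedBall_self hδ.le
  refine (hasDerivAt_integral_of_dominated_loc_of_deriv_le (μ := μ)
    (bound := fun w => ‖ρ w‖ * (|a| * M'))
    (F' := fun x w => (ρ w : ℂ) *
      (((-a : ℝ) : ℂ) * (1 - x * τ w) ^ (((-a : ℝ) : ℂ) - 1) * (-(τ w : ℂ))))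
    (Metric.closedBall_mem_nhds x₀ hδ) (Eventually.of_forall fun x => ?_) ?_ ?_ ?_ ?_ ?_
    ).2.differentiableAt.differentiableWithinAt
  · exact hρC.1.mul (hmeas _ _)
  · exact hρC.mul_bdd (hmeas _ _) (hτ01.mono fun w hw => hM (x₀, τ w) ⟨hmem, hw⟩)
  · exact hρC.1.mul (((hmeas _ _).const_mul _).mul
      (by exact (Complex.measurable_ofReal.comp hτ).neg.aestronglyMeasurable))
  · filter_upwards [hτ01] with w hw x hx
    rw [norm_mul, norm_mul, norm_mul, norm_neg, Complex.norm_real, Complex.norm_real,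
      Complex.norm_real, norm_neg, Real.norm_eq_abs a, Real.norm_of_nonneg hw.1]
    have h1 := hM' (x, τ w) ⟨hx, hw⟩
    have h0 : 0 ≤ |a| * ‖(1 - x * (τ w : ℂ)) ^ (((-a : ℝ) : ℂ) - 1)‖ := by positivity
    exact mul_le_mul_of_nonneg_left ((mul_le_of_le_one_right h0 hw.2).trans
      (mul_le_mul_of_nonneg_left h1 (abs_nonneg a))) (norm_nonneg _)
  · exact hρ.norm.mul_const _
  · filter_upwards [hτ01] with w hw x hx
    refine HasDerivAt.const_mul _ (HasDerivAt.cpow_const ?_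
      (one_sub_mul_mem_slitPlane (hball hx) hw))
    simpa using ((hasDerivAt_id x).mul_const (τ w : ℂ)).const_sub 1

theorem analyticAt_eulerIntegral {μ : Measure ℝ} {ρ τ : ℝ → ℝ} (a : ℝ)
    (hρ : Integrable ρ μ) (hτ : Measurable τ) (hτ01 : ∀ᵐ w ∂μ, τ w ∈ Icc (0 : ℝ) 1) {x : ℂ}
    (hx : 1 - x ∈ Complex.slitPlane) : AnalyticAt ℂ (eulerIntegral μ ρ τ a) x :=
  (differentiableOn_eulerIntegral a hρ hτ hτ01).analyticAt
    (isOpen_one_sub_mem_slitPlane.mem_nhds hx)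

/-- Negative `x` is included because the Pfaff transformation sends (0,1) to negative values
x/(x-1). -/
theorem eulerIntegral_ofReal {μ : Measure ℝ} {ρ τ : ℝ → ℝ} (a : ℝ)
    (hτ01 : ∀ᵐ w ∂μ, τ w ∈ Icc (0 : ℝ) 1) {x : ℝ} (hx : x < 1) :
    eulerIntegral μ ρ τ a x = ((∫ w, ρ w * (1 - x * τ w) ^ (-a) ∂μ : ℝ) : ℂ) := by
  rw [eulerIntegral, ← integral_complex_ofReal]
  refine integral_congr_ae (hτ01.mono fun w hw => ?_)
  have : 0 ≤ 1 - x * τ w := by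
    nlinarith [mul_nonneg hw.1 (sub_nonneg.2 hx.le), hw.2]
  simp only [Complex.ofReal_mul, Complex.ofReal_cpow this]
  push_cast
  rfl

/-! ### Contour integration in the upper half-plane -/

/-- Cauchy's theorem on the rectangle [-T,T] × [ε₁,ε₂]; the vertical sides are bounded by D(±T)(ε₂ -
ε₁) and disappear as T → ∞. The finite set `S` stands for the branch points, where a bound such as
|u|^(-a) takes the default value 0 and dominates nothing. -/
theorem integral_horizontal_eq {f : ℂ → ℂ} {D : ℝ → ℝ} {S : Set ℝ} (hS : S.Finite)
    (hf : DifferentiableOn ℂ f {z | 0 < z.im}) (hD : Integrable D)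
    (hfD : ∀ u ∉ S, ∀ ε : ℝ, 0 < ε → ‖f (u + ε * Complex.I)‖ ≤ D u)
    (hDtop : Tendsto D atTop (𝓝 0)) (hDbot : Tendsto D atBot (𝓝 0)) {ε₁ ε₂ : ℝ}
    (h₁ : 0 < ε₁) (h₁₂ : ε₁ ≤ ε₂) :
    ∫ u : ℝ, f (u + ε₁ * Complex.I) = ∫ u : ℝ, f (u + ε₂ * Complex.I) := by
  have hint : ∀ ε : ℝ, 0 < ε → Integrable fun u : ℝ => f (u + ε * Complex.I) := fun ε hε => by
    refine hD.mono' (Continuous.aestronglyMeasurable ?_) ?_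
    · exact hf.continuousOn.comp_continuous (by fun_prop) fun u => by simpa using hε
    · filter_upwards [hS.measure_zero volume |> compl_mem_ae_iff.2] with u hu
      exact hfD u hu ε hε
  have h₂ : 0 < ε₂ := h₁.trans_le h₁₂
  have hrect : ∀ T : ℝ,
      (∫ u in (-T)..T, f (u + ε₁ * Complex.I)) - (∫ u in (-T)..T, f (u + ε₂ * Complex.I)) =
        Complex.I • (∫ y in ε₁..ε₂, f (((-T : ℝ) : ℂ) + y * Complex.I)) -
        Complex.I • ∫ y in ε₁..ε₂, f ((T : ℂ) + y * Complex.I) := fun T => by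
    have := Complex.integral_boundary_rect_eq_zero_of_differentiableOn f
      ((-T : ℝ) + ε₁ * Complex.I) (T + ε₂ * Complex.I) (hf.mono fun z hz => by
        have := hz.2
        simp only [Complex.add_im, Complex.ofReal_im, Complex.mul_im, Complex.I_im, Complex.I_re,
          Complex.ofReal_re, mul_one, mul_zero, add_zero, zero_add, uIcc_of_le h₁₂,
          mem_preimage] at this
        exact h₁.trans_le this.1)
    simp only [Complex.add_im, Complex.add_re, Complex.ofReal_im, Complex.mul_im, Complex.mul_re,
      Complex.I_im, Complex.I_re, Complex.ofReal_re, mul_one, mul_zero, add_zero, zero_add,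
      sub_zero] at this
    linear_combination this
  have hside : ∀ σ : ℝ → ℝ, Tendsto (fun T => D (σ T)) atTop (𝓝 0) →
      (∀ᶠ T in atTop, σ T ∉ S) →
      Tendsto (fun T : ℝ => ∫ y in ε₁..ε₂, f ((σ T : ℂ) + y * Complex.I)) atTop (𝓝 0) := by
    intro σ hσ hσS
    refine squeeze_zero_norm' (a := fun T => D (σ T) * |ε₂ - ε₁|) ?_ (by simpa using hσ.mul_const _)
    filter_upwards [hσS] with T hT
    refine intervalIntegral.norm_integral_le_of_norm_le_const fun y hy => hfD _ hT _ ?_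
    rw [uIoc_of_le h₁₂] at hy
    exact h₁.trans hy.1
  have hlim₁ := (intervalIntegral_tendsto_integral (hint ε₁ h₁) tendsto_neg_atTop_atBot
    tendsto_id).sub (intervalIntegral_tendsto_integral (hint ε₂ h₂) tendsto_neg_atTop_atBot
    tendsto_id)
  have hSbot : ∀ᶠ T in atBot, T ∉ S := by
    obtain ⟨b, hb⟩ := hS.bddBelow
    filter_upwards [eventually_lt_atBot b] with T hT hTS
    exact absurd (hb hTS) (not_le.2 hT)
  have hStop : ∀ᶠ T in atTop, T ∉ S := by
    obtain ⟨b, hb⟩ := hS.bddAbove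
    filter_upwards [eventually_gt_atTop b] with T hT hTS
    exact absurd (hb hTS) (not_le.2 hT)
  have hlim₂ := ((hside (fun T => -T) (hDbot.comp tendsto_neg_atTop_atBot)
    (tendsto_neg_atTop_atBot.eventually hSbot)).const_smul Complex.I).sub
    ((hside (fun T => T) hDtop hStop).const_smul Complex.I)
  simp only [smul_zero, sub_zero] at hlim₂
  exact sub_eq_zero.1 (tendsto_nhds_unique (hlim₁.congr fun T => hrect T) hlim₂)

/-- The integral over the real line of the boundary value of a function that is holomorphic on
the upper half-plane, dominated on horizontal lines and vanishing at `i∞`. -/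
theorem integral_boundary_eq_zero {f : ℂ → ℂ} {g : ℝ → ℂ} {D : ℝ → ℝ} {S : Set ℝ}
    (hS : S.Finite) (hf : DifferentiableOn ℂ f {z | 0 < z.im}) (hD : Integrable D)
    (hfD : ∀ u ∉ S, ∀ ε : ℝ, 0 < ε → ‖f (u + ε * Complex.I)‖ ≤ D u)
    (hDtop : Tendsto D atTop (𝓝 0)) (hDbot : Tendsto D atBot (𝓝 0))
    (hinf : ∀ u : ℝ, Tendsto (fun ε : ℝ => f (u + ε * Complex.I)) atTop (𝓝 0))
    (hg : ∀ u ∉ S, Tendsto (fun ε : ℝ => f (u + ε * Complex.I)) (𝓝[>] 0) (𝓝 (g u))) :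
    ∫ u, g u = 0 := by
  have hae : ∀ᵐ u : ℝ, u ∉ S := hS.measure_zero volume |> compl_mem_ae_iff.2
  have hmeas : ∀ ε : ℝ, 0 < ε →
      AEStronglyMeasurable (fun u : ℝ => f (u + ε * Complex.I)) volume := fun ε hε =>
    (hf.continuousOn.comp_continuous (by fun_prop) fun u => by
      simpa using hε).aestronglyMeasurable
  -- The integral along a horizontal line does not depend on its height, and it tends to 0 as the
  -- height goes to infinity.
  have hzero : ∀ ε : ℝ, 0 < ε → ∫ u : ℝ, f (u + ε * Complex.I) = 0 := fun ε hε => by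
    have h : Tendsto (fun ε' : ℝ => ∫ u : ℝ, f (u + ε' * Complex.I)) atTop
        (𝓝 (∫ _ : ℝ, (0 : ℂ))) := by
      refine tendsto_integral_filter_of_dominated_convergence D ?_ ?_ hD
        (Eventually.of_forall hinf)
      · filter_upwards [eventually_gt_atTop 0] with ε' hε' using hmeas ε' hε'
      · filter_upwards [eventually_gt_atTop 0] with ε' hε'
        filter_upwards [hae] with u hu using hfD u hu ε' hε'
    rw [integral_zero] at h
    refine tendsto_nhds_unique (tendsto_const_nhds.congr' ?_) h
    filter_upwards [eventually_ge_atTop ε] with ε' hε'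
    exact integral_horizontal_eq hS hf hD hfD hDtop hDbot hε hε'
  have h : Tendsto (fun ε : ℝ => ∫ u : ℝ, f (u + ε * Complex.I)) (𝓝[>] 0) (𝓝 (∫ u, g u)) := by
    refine tendsto_integral_filter_of_dominated_convergence D ?_ ?_ hD (hae.mono hg)
    · filter_upwards [self_mem_nhdsWithin] with ε' hε' using hmeas ε' hε'
    · filter_upwards [self_mem_nhdsWithin] with ε' hε'
      filter_upwards [hae] with u hu using hfD u hu ε' hε'
  refine tendsto_nhds_unique (h.congr' ?_) tendsto_const_nhds
  filter_upwards [self_mem_nhdsWithin] with ε hε using hzero ε hε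

/-! ### Convergence and Pfaff transformations of the real integrals -/

/-- The real values of `eulerIntegral`. -/
noncomputable def eulerReal (μ : Measure ℝ) (ρ τ : ℝ → ℝ) (a x : ℝ) : ℝ :=
  ∫ w, ρ w * (1 - x * τ w) ^ (-a) ∂μ

theorem integrable_euler {μ : Measure ℝ} {ρ τ : ℝ → ℝ} {a : ℝ} (ha : 0 ≤ a)
    (hρ : Integrable ρ μ) (hτ : Measurable τ) (hτ01 : ∀ᵐ w ∂μ, τ w ∈ Icc (0 : ℝ) 1) {x : ℝ}
    (hx0 : 0 ≤ x) (hx : x < 1) : Integrable (fun w => ρ w * (1 - x * τ w) ^ (-a)) μ := by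
  refine hρ.mul_bdd (c := (1 - x) ^ (-a)) ?_ (hτ01.mono fun w hw => ?_)
  · exact Measurable.aestronglyMeasurable (by fun_prop)
  · have h : 1 - x ≤ 1 - x * τ w := by nlinarith [hw.2]
    rw [Real.norm_of_nonneg (Real.rpow_nonneg (by linarith) _)]
    exact Real.rpow_le_rpow_of_nonpos (by linarith) h (by linarith)

/-- The density of the Euler integral of the first block. -/
noncomputable def betaDensity (a t : ℝ) : ℝ := (t * (1 - t)) ^ (-a)

/-- The density of the Euler integral of the second block. -/
noncomputable def tailDensity (a w : ℝ) : ℝ := (w * w * (w - 1)) ^ (-a)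

/-- This is the Beta integral B(1-a, 1-a). -/
theorem integrableOn_betaDensity {a : ℝ} (ha : a < 1) :
    IntegrableOn (betaDensity a) (Ioo 0 1) := by
  have h := Complex.betaIntegral_convergent (u := ((1 - a : ℝ) : ℂ)) (v := ((1 - a : ℝ) : ℂ))
    (by simpa using ha) (by simpa using ha)
  rw [intervalIntegrable_iff_integrableOn_Ioo_of_le zero_le_one] at h
  refine IntegrableOn.congr_fun h.norm (fun t ht => ?_) measurableSet_Ioo
  have h1 : (1 - (t : ℂ)) = ((1 - t : ℝ) : ℂ) := by push_cast; rfl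
  have h2 : ((1 - a : ℝ) : ℂ) - 1 = ((-a : ℝ) : ℂ) := by push_cast; ring
  simp only [betaDensity]
  rw [norm_mul, h1, h2, Complex.norm_cpow_real, Complex.norm_cpow_real, Complex.norm_real,
    Complex.norm_real, Real.norm_of_nonneg ht.1.le, Real.norm_of_nonneg (by linarith [ht.2]),
    Real.mul_rpow ht.1.le (by linarith [ht.2])]

/-- On (1,2] the density is dominated by (w-1)^(-a), integrable as a < 1; beyond 2 by (w-1)^(-3a),
integrable as 3a > 1. -/
theorem integrableOn_tailDensity {a : ℝ} (ha : a < 1) (ha3 : 1 < 3 * a) :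
    IntegrableOn (tailDensity a) (Ioi 1) := by
  have hmeas : Measurable (tailDensity a) := by unfold tailDensity; fun_prop
  have hshift : ∀ (f : ℝ → ℝ) (s : Set ℝ), IntegrableOn f s →
      IntegrableOn (fun w => f (w - 1)) ((fun w => w - 1) ⁻¹' s) := fun f s hf =>
    ((measurePreserving_sub_right volume (1 : ℝ)).integrableOn_comp_preimage
      (MeasurableEquiv.subRight (1 : ℝ)).measurableEmbedding).2 hf
  have h1 : IntegrableOn (tailDensity a) (Ioc 1 2) := by
    have h := hshift _ _ ((intervalIntegrable_iff_integrableOn_Ioc_of_le zero_le_one).1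
      (intervalIntegral.intervalIntegrable_rpow' (a := 0) (b := 1) (r := -a) (by linarith)))
    rw [preimage_sub_const_Ioc, zero_add, one_add_one_eq_two] at h
    refine h.mono' hmeas.aestronglyMeasurable
      ((ae_restrict_mem measurableSet_Ioc).mono fun w hw => ?_)
    have h0 : 0 < w - 1 := sub_pos.2 hw.1
    have h1 : w - 1 ≤ w * w * (w - 1) := by
      have : 1 ≤ w * w := by nlinarith [hw.1]
      nlinarith
    rw [tailDensity, Real.norm_of_nonneg (Real.rpow_nonneg (h0.le.trans h1) _)]
    exact Real.rpow_le_rpow_of_nonpos h0 h1 (by linarith)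
  have h2 : IntegrableOn (tailDensity a) (Ioi 2) := by
    have h := hshift _ _ (integrableOn_Ioi_rpow_of_lt (a := -(3 * a)) (by linarith) one_pos)
    rw [preimage_sub_const_Ioi, one_add_one_eq_two] at h
    refine h.mono' hmeas.aestronglyMeasurable
      ((ae_restrict_mem measurableSet_Ioi).mono fun w hw => ?_)
    have hw' : 2 < w := hw
    have h0 : 0 < w - 1 := by linarith
    have h1 : (w - 1) ^ 3 ≤ w * w * (w - 1) := by nlinarith
    rw [tailDensity, Real.norm_of_nonneg (Real.rpow_nonneg (by positivity) _)]
    refine (Real.rpow_le_rpow_of_nonpos (by positivity) h1 (by linarith)).trans_eq ?_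
    rw [← Real.rpow_natCast, ← Real.rpow_mul h0.le]
    congr 1; push_cast; ring
  rw [← Ioc_union_Ioi_eq_Ioi (one_le_two (α := ℝ))]
  exact h1.union h2

theorem integrand_scaling {a x t : ℝ} (hx : x ∈ Ioo (0 : ℝ) 1) (ht : t ∈ Ioo (0 : ℝ) 1) :
    (x * t * (x - x * t) * (1 - x * t)) ^ (-a) =
      x ^ (-(2 * a)) * (betaDensity a t * (1 - x * t) ^ (-a)) := by
  have h0 : 0 ≤ 1 - x * t := by nlinarith [hx.1, hx.2, ht.1, ht.2]
  have h1 : 0 ≤ t * (1 - t) := mul_nonneg ht.1.le (by linarith [ht.2])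
  have h2 : x ^ (-(2 * a)) = (x * x) ^ (-a) := by
    rw [← pow_two, ← Real.rpow_natCast, ← Real.rpow_mul hx.1.le]; congr 1; push_cast; ring
  rw [betaDensity, h2, ← Real.mul_rpow h1 h0, ← Real.mul_rpow (by nlinarith [hx.1])
    (mul_nonneg h1 h0)]
  congr 1; ring

theorem ae_mem_Icc_of_Ioo : ∀ᵐ t ∂(volume.restrict (Ioo (0 : ℝ) 1)), id t ∈ Icc (0 : ℝ) 1 :=
  (ae_restrict_mem measurableSet_Ioo).mono fun _ ht => Ioo_subset_Icc_self ht

theorem ae_inv_mem_Icc : ∀ᵐ w ∂(volume.restrict (Ioi (1 : ℝ))), w⁻¹ ∈ Icc (0 : ℝ) 1 :=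
  (ae_restrict_mem measurableSet_Ioi).mono fun w hw =>
    ⟨by have : (1 : ℝ) < w := hw; positivity, inv_le_one_of_one_le₀ (le_of_lt hw)⟩

theorem integrableOn_near {a x : ℝ} (ha0 : 0 ≤ a) (ha : a < 1) (hx : x ∈ Ioo (0 : ℝ) 1) :
    IntegrableOn (fun w => (w * (x - w) * (1 - w)) ^ (-a)) (Ioo 0 x) := by
  have h := integrable_euler ha0 (integrableOn_betaDensity ha) measurable_id ae_mem_Icc_of_Ioo
    hx.1.le hx.2
  have h1 : IntegrableOn (fun t => (x * t * (x - x * t) * (1 - x * t)) ^ (-a)) (Ioo 0 1) :=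
    IntegrableOn.congr_fun (h.const_mul (x ^ (-(2 * a))))
      (fun t ht => (integrand_scaling hx ht).symm) measurableSet_Ioo
  rw [← intervalIntegrable_iff_integrableOn_Ioo_of_le zero_le_one] at h1
  have h2 := h1.comp_mul_left (c := x⁻¹)
  rw [← intervalIntegrable_iff_integrableOn_Ioo_of_le hx.1.le]
  have hx0 := hx.1.ne'
  simpa [mul_inv_cancel_left₀ hx0] using h2

theorem integral_near {a x : ℝ} (hx : x ∈ Ioo (0 : ℝ) 1) :
    ∫ w in Ioo 0 x, (w * (x - w) * (1 - w)) ^ (-a) =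
      x ^ (1 - 2 * a) * eulerReal (volume.restrict (Ioo 0 1)) (betaDensity a) id a x := by
  have h := intervalIntegral.integral_comp_mul_left
    (fun w => (w * (x - w) * (1 - w)) ^ (-a)) hx.1.ne' (a := 0) (b := 1)
  rw [mul_zero, mul_one, intervalIntegral.integral_of_le hx.1.le,
    intervalIntegral.integral_of_le zero_le_one, integral_Ioc_eq_integral_Ioo,
    integral_Ioc_eq_integral_Ioo, setIntegral_congr_fun measurableSet_Ioo
      (fun t ht => integrand_scaling hx ht), integral_const_mul, smul_eq_mul,
    eq_inv_mul_iff_mul_eq₀ hx.1.ne'] at h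
  rw [← h, eulerReal, ← mul_assoc, sub_eq_add_neg, Real.rpow_add hx.1, Real.rpow_one]
  rfl

theorem tail_eq {a x w : ℝ} (hx : x < 1) (hw : 1 < w) :
    (w * (w - x) * (w - 1)) ^ (-a) = tailDensity a w * (1 - x * w⁻¹) ^ (-a) := by
  have hw0 : 0 < w := by linarith
  have h1 : 1 - x * w⁻¹ = (w - x) / w := by field_simp
  rw [tailDensity, h1, ← Real.mul_rpow (mul_nonneg (by positivity) (by linarith))
    (div_nonneg (by linarith) hw0.le)]
  congr 1
  field_simp

theorem integrableOn_tail {a x : ℝ} (ha : a < 1) (ha3 : 1 < 3 * a) (hx : x ∈ Ioo (0 : ℝ) 1) :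
    IntegrableOn (fun w => (w * (w - x) * (w - 1)) ^ (-a)) (Ioi 1) :=
  IntegrableOn.congr_fun (integrable_euler (by linarith) (integrableOn_tailDensity ha ha3)
      measurable_inv ae_inv_mem_Icc hx.1.le hx.2)
    (fun _ hw => (tail_eq hx.2 hw).symm) measurableSet_Ioi

theorem integral_tail {a x : ℝ} (hx : x < 1) :
    ∫ w in Ioi 1, (w * (w - x) * (w - 1)) ^ (-a) =
      eulerReal (volume.restrict (Ioi 1)) (tailDensity a) Inv.inv a x :=
  setIntegral_congr_fun measurableSet_Ioi fun _ hw => tail_eq hx hw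

/-- Substitute t → 1-t, which preserves the density, and use 1 - (x/(x-1)) t = (1 - x(1-t))/(1-x).
-/
theorem eulerReal_beta_pfaff {a x : ℝ} (hx : x < 1) :
    eulerReal (volume.restrict (Ioo 0 1)) (betaDensity a) id a (x / (x - 1)) =
      (1 - x) ^ a * eulerReal (volume.restrict (Ioo 0 1)) (betaDensity a) id a x := by
  have h := intervalIntegral.integral_comp_sub_left
    (fun t => betaDensity a t * (1 - x * t) ^ (-a)) (1 : ℝ) (a := 0) (b := 1)
  rw [sub_self, sub_zero, intervalIntegral.integral_of_le zero_le_one,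
    intervalIntegral.integral_of_le zero_le_one, integral_Ioc_eq_integral_Ioo,
    integral_Ioc_eq_integral_Ioo] at h
  simp only [eulerReal, id_eq]
  rw [← h, ← integral_const_mul]
  refine setIntegral_congr_fun measurableSet_Ioo fun t ht => ?_
  have h1 : 0 < 1 - x := by linarith
  have h2 : 0 ≤ 1 - x * (1 - t) := by nlinarith [ht.1, ht.2]
  have h3 : x - 1 ≠ 0 := by linarith
  have h4 : 1 - x / (x - 1) * t = (1 - x * (1 - t)) / (1 - x) := by
    field_simp; ring
  have h5 : betaDensity a (1 - t) = betaDensity a t := by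
    simp only [betaDensity]; congr 1; ring
  simp only [h4, h5]
  rw [Real.div_rpow h2 h1.le, Real.rpow_neg h1.le a, div_inv_eq_mul]
  ring

/-- The affine map w ↦ (w-x)/(1-x) fixes 1 and ∞ and sends x to 0 and 0 to x/(x-1). Each of the
three factors is divided by 1-x, which gives (1-x)^(3a); the Jacobian contributes the remaining
(1-x)^(-1). -/
theorem eulerReal_tail_pfaff {a x : ℝ} (hx : x < 1) :
    eulerReal (volume.restrict (Ioi 1)) (tailDensity a) Inv.inv a (x / (x - 1)) =
      (1 - x) ^ (3 * a - 1) *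
        eulerReal (volume.restrict (Ioi 1)) (tailDensity a) Inv.inv a x := by
  have h1 : 0 < 1 - x := by linarith
  have hx' : x / (x - 1) < 1 := by
    rw [div_lt_one_of_neg (by linarith)]; linarith
  rw [← integral_tail hx, ← integral_tail hx', ← integral_const_mul]
  have himage : (fun w => (w - x) / (1 - x)) '' Ioi 1 = Ioi 1 := by
    ext w
    simp only [mem_image, mem_Ioi]
    refine ⟨?_, fun hw => ⟨w * (1 - x) + x, by nlinarith, by field_simp; ring⟩⟩
    rintro ⟨v, hv, rfl⟩
    rw [one_lt_div h1]; linarith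
  have hinj : InjOn (fun w => (w - x) / (1 - x)) (Ioi 1) := fun v _ w _ hvw => by
    have h := (div_left_inj' h1.ne').1 hvw
    linarith
  have h := integral_image_eq_integral_abs_deriv_smul (measurableSet_Ioi (a := (1 : ℝ)))
    (f := fun w => (w - x) / (1 - x)) (f' := fun _ => 1 / (1 - x))
    (fun w _ => (((hasDerivAt_id w).sub_const x).div_const (1 - x)).hasDerivWithinAt) hinj
    (fun w => (w * (w - x / (x - 1)) * (w - 1)) ^ (-a))
  rw [himage] at h
  rw [h]
  refine setIntegral_congr_fun measurableSet_Ioi fun w hw => ?_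
  have hw' : 1 < w := hw
  have h3 : x - 1 ≠ 0 := by linarith
  have h4 : (w - x) / (1 - x) * ((w - x) / (1 - x) - x / (x - 1)) * ((w - x) / (1 - x) - 1) =
      (w * (w - x) * (w - 1)) / (1 - x) ^ (3 : ℝ) := by
    have : (1 - x) ^ (3 : ℝ) = (1 - x) ^ 3 := by exact_mod_cast Real.rpow_natCast (1 - x) 3
    rw [this, div_sub_div _ _ h1.ne' h3, div_sub_one h1.ne']
    field_simp
    ring
  have h5 : 0 ≤ w * (w - x) * (w - 1) :=
    mul_nonneg (mul_nonneg (by linarith) (by linarith)) (by linarith)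
  simp only [smul_eq_mul]
  rw [h4, Real.div_rpow h5 (by positivity), ← Real.rpow_mul h1.le, abs_of_pos (by positivity),
    show 3 * a - 1 = -(3 * -a) + -1 by ring, Real.rpow_add h1, Real.rpow_neg h1.le,
    Real.rpow_neg_one]
  field_simp

theorem eulerReal_pos {μ : Measure ℝ} {ρ τ : ℝ → ℝ} {a x : ℝ} (hμ : μ ≠ 0)
    (hint : Integrable (fun w => ρ w * (1 - x * τ w) ^ (-a)) μ)
    (hρ : ∀ᵐ w ∂μ, 0 < ρ w) (hτ01 : ∀ᵐ w ∂μ, τ w ∈ Icc (0 : ℝ) 1) (hx : x < 1) :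
    0 < eulerReal μ ρ τ a x := by
  have hpos : ∀ᵐ w ∂μ, 0 < ρ w * (1 - x * τ w) ^ (-a) := by
    filter_upwards [hρ, hτ01] with w h1 h2
    refine mul_pos h1 (Real.rpow_pos_of_pos ?_ _)
    nlinarith [mul_nonneg h2.1 (sub_nonneg.2 hx.le), h2.2, h2.1]
  rw [eulerReal, integral_pos_iff_support_of_nonneg_ae (hpos.mono fun w hw => hw.le) hint]
  refine pos_iff_ne_zero.2 fun h0 => hμ ?_
  have h1 : ∀ᵐ w ∂μ, False := by
    filter_upwards [hpos, measure_eq_zero_iff_ae_notMem.1 h0] with w hw hw'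
    exact hw' hw.ne'
  rwa [eventually_false_iff_eq_bot, ae_eq_bot] at h1

/-! ### The linear relation between the integrals over the four intervals -/

/-- On the negative axis the principal argument is π, its limit from above, so the principal power
is continuous from the closed upper half-plane. -/
theorem tendsto_cpow_from_above {u : ℝ} (hu : u ≠ 0) (c : ℂ) :
    Tendsto (fun ε : ℝ => ((u : ℂ) + ε * Complex.I) ^ c) (𝓝[>] 0) (𝓝 ((u : ℂ) ^ c)) := by
  have hline : Tendsto (fun ε : ℝ => (u : ℂ) + ε * Complex.I) (𝓝[>] 0)
      (𝓝[{z | 0 ≤ z.im}] (u : ℂ)) := by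
    refine tendsto_nhdsWithin_iff.2 ⟨?_, ?_⟩
    · have : Continuous fun ε : ℝ => (u : ℂ) + ε * Complex.I := by fun_prop
      simpa using (this.tendsto 0).mono_left nhdsWithin_le_nhds
    · filter_upwards [self_mem_nhdsWithin] with ε hε
      simpa using le_of_lt hε
  have hlog : ContinuousWithinAt Complex.log {z | 0 ≤ z.im} (u : ℂ) := by
    rcases hu.lt_or_gt with h | h
    · exact Complex.continuousWithinAt_log_of_re_neg_of_im_zero (by simpa) (by simp)
    · exact (continuousAt_clog (Complex.ofReal_mem_slitPlane.2 h)).continuousWithinAt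
  have h := ((hlog.tendsto.comp hline).mul_const c).cexp
  rw [Complex.cpow_def_of_ne_zero (by exact_mod_cast hu)]
  refine h.congr' ?_
  filter_upwards [self_mem_nhdsWithin] with ε hε
  have hne : (u : ℂ) + ε * Complex.I ≠ 0 := fun h0 => by
    have := congrArg Complex.im h0
    simp at this
    exact (ne_of_gt hε) this
  simp [Complex.cpow_def_of_ne_zero hne]

theorem integral_comp_one_sub (f : ℝ → ℝ) (s : Set ℝ) :
    ∫ u in (fun u => 1 - u) ⁻¹' s, f (1 - u) = ∫ u in s, f u :=
  (Measure.measurePreserving_sub_left volume (1 : ℝ)).setIntegral_preimage_emb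
    (MeasurableEquiv.subLeft (1 : ℝ)).measurableEmbedding f s

theorem integrableOn_comp_one_sub {f : ℝ → ℝ} {s : Set ℝ} :
    IntegrableOn (fun u => f (1 - u)) ((fun u => 1 - u) ⁻¹' s) ↔ IntegrableOn f s :=
  (Measure.measurePreserving_sub_left volume (1 : ℝ)).integrableOn_comp_preimage
    (MeasurableEquiv.subLeft (1 : ℝ)).measurableEmbedding

/-- The modulus of the three-point integrand on the real line. -/
noncomputable def modulus (a x u : ℝ) : ℝ := |u| ^ (-a) * |u - x| ^ (-a) * |u - 1| ^ (-a)

theorem modulus_eq (a x u : ℝ) : modulus a x u = |u * (u - x) * (u - 1)| ^ (-a) := by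
  rw [modulus, ← Real.mul_rpow (abs_nonneg _) (abs_nonneg _), ← abs_mul,
    ← Real.mul_rpow (abs_nonneg _) (abs_nonneg _), ← abs_mul]

theorem modulus_one_sub (a x u : ℝ) : modulus a x (1 - u) = modulus a (1 - x) u := by
  rw [modulus, modulus, abs_sub_comm 1 u, show 1 - u - x = -(u - (1 - x)) by ring,
    show 1 - u - 1 = -u by ring, abs_neg, abs_neg]
  ring

theorem modulus_near (a : ℝ) {x w : ℝ} (hx : x ∈ Ioo (0 : ℝ) 1) (hw : w ∈ Ioo 0 x) :
    modulus a x w = (w * (x - w) * (1 - w)) ^ (-a) := by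
  rw [modulus_eq, show w * (w - x) * (w - 1) = w * (x - w) * (1 - w) by ring, abs_of_nonneg]
  exact mul_nonneg (mul_nonneg hw.1.le (by linarith [hw.2])) (by linarith [hw.2, hx.2])

theorem modulus_tail (a : ℝ) {x w : ℝ} (hx : x ∈ Ioo (0 : ℝ) 1) (hw : w ∈ Ioi (1 : ℝ)) :
    modulus a x w = (w * (w - x) * (w - 1)) ^ (-a) := by
  have hw' : 1 < w := hw
  rw [modulus_eq, abs_of_nonneg]
  exact mul_nonneg (mul_nonneg (by linarith) (by linarith [hx.2])) (by linarith)

/-- The reflection u → 1-u carries (x,1) and (-∞,0) to the intervals of `hnear` and `htail` for 1-x.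
-/
theorem integrable_modulus {a : ℝ}
    (hnear : ∀ x ∈ Ioo (0 : ℝ) 1,
      IntegrableOn (fun w => (w * (x - w) * (1 - w)) ^ (-a)) (Ioo 0 x))
    (htail : ∀ x ∈ Ioo (0 : ℝ) 1,
      IntegrableOn (fun w => (w * (w - x) * (w - 1)) ^ (-a)) (Ioi 1))
    {x : ℝ} (hx : x ∈ Ioo (0 : ℝ) 1) : Integrable (modulus a x) := by
  have h1 : ∀ x ∈ Ioo (0 : ℝ) 1, IntegrableOn (modulus a x) (Ioo 0 x) := fun x hx =>
    (hnear x hx).congr_fun (fun w hw => (modulus_near a hx hw).symm) measurableSet_Ioo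
  have h2 : ∀ x ∈ Ioo (0 : ℝ) 1, IntegrableOn (modulus a x) (Ioi 1) := fun x hx =>
    (htail x hx).congr_fun (fun w hw => (modulus_tail a hx hw).symm) measurableSet_Ioi
  have hx' : 1 - x ∈ Ioo (0 : ℝ) 1 := ⟨by linarith [hx.2], by linarith [hx.1]⟩
  have h3 := integrableOn_comp_one_sub.2 (h1 _ hx')
  have h4 := integrableOn_comp_one_sub.2 (h2 _ hx')
  simp only [modulus_one_sub, sub_sub_cancel] at h3 h4
  rw [preimage_const_sub_Ioo, sub_sub_cancel, sub_zero,
    ← integrableOn_Ioc_iff_integrableOn_Ioo] at h3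
  rw [preimage_const_sub_Ioi, sub_self, ← integrableOn_Iic_iff_integrableOn_Iio] at h4
  have h1' := (integrableOn_Ioc_iff_integrableOn_Ioo (by simp)).2 (h1 x hx)
  have hu := h4.union (h1'.union (h3.union (h2 x hx)))
  rwa [Ioc_union_Ioi_eq_Ioi hx.2.le, Ioc_union_Ioi_eq_Ioi hx.1.le, Iic_union_Ioi,
    integrableOn_univ] at hu

theorem integral_split {x : ℝ} (hx : x ∈ Ioo (0 : ℝ) 1) {g : ℝ → ℂ} (hg : Integrable g) :
    ∫ u, g u = (∫ u in Iio 0, g u) + (∫ u in Ioo 0 x, g u) + (∫ u in Ioo x 1, g u) +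
      ∫ u in Ioi 1, g u := by
  rw [← intervalIntegral.integral_Iic_add_Ioi (b := (0 : ℝ)) hg.integrableOn hg.integrableOn,
    ← Ioc_union_Ioi_eq_Ioi hx.1.le, setIntegral_union (Ioc_disjoint_Ioi le_rfl)
      measurableSet_Ioi hg.integrableOn hg.integrableOn,
    ← Ioc_union_Ioi_eq_Ioi hx.2.le, setIntegral_union (Ioc_disjoint_Ioi le_rfl)
      measurableSet_Ioi hg.integrableOn hg.integrableOn, integral_Iic_eq_integral_Iio,
    integral_Ioc_eq_integral_Ioo, integral_Ioc_eq_integral_Ioo]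
  ring

theorem tendsto_modulus {a : ℝ} (ha : 0 < a) (x : ℝ) {l : Filter ℝ}
    (hl : ∀ c : ℝ, Tendsto (fun u => |u - c|) l atTop) : Tendsto (modulus a x) l (𝓝 0) := by
  have h : ∀ c : ℝ, Tendsto (fun u => |u - c| ^ (-a)) l (𝓝 0) := fun c =>
    (tendsto_rpow_neg_atTop ha).comp (hl c)
  have h' := ((h 0).mul (h x)).mul (h 1)
  simp only [sub_zero, mul_zero] at h'
  exact h'

theorem ofReal_cpow_neg_exponent (a : ℝ) {u : ℝ} (hu : u < 0) :
    (u : ℂ) ^ ((-a : ℝ) : ℂ) =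
      ((|u| ^ (-a) : ℝ) : ℂ) * Complex.exp (Real.pi * Complex.I * ((-a : ℝ) : ℂ)) := by
  rw [Complex.ofReal_cpow_of_nonpos hu.le, Complex.ofReal_cpow (abs_nonneg u), abs_of_neg hu]
  push_cast
  rfl

theorem ofReal_cpow_abs (a : ℝ) {u : ℝ} (hu : 0 ≤ u) :
    (u : ℂ) ^ ((-a : ℝ) : ℂ) = ((|u| ^ (-a) : ℝ) : ℂ) := by
  rw [Complex.ofReal_cpow (abs_nonneg u), abs_of_nonneg hu]

theorem contour_relation {a x : ℝ} (ha : 0 < a) (hx : x ∈ Ioo (0 : ℝ) 1)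
    (hint : Integrable (modulus a x)) :
    Real.sin (Real.pi * a) * (∫ u in Ioo 0 x, modulus a x u) +
      Real.sin (2 * (Real.pi * a)) * (∫ u in Ioo x 1, modulus a x u) +
      Real.sin (3 * (Real.pi * a)) * (∫ u in Ioi 1, modulus a x u) = 0 := by
  set c : ℂ := ((-a : ℝ) : ℂ) with hc
  set f : ℂ → ℂ := fun z => z ^ c * (z - (x : ℂ)) ^ c * (z - ((1 : ℝ) : ℂ)) ^ c with hf
  set g : ℝ → ℂ := fun u => (u : ℂ) ^ c * ((u - x : ℝ) : ℂ) ^ c * ((u - 1 : ℝ) : ℂ) ^ c with hg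
  set E : ℂ := Complex.exp (Real.pi * Complex.I * c) with hE
  have hshift : ∀ u ε v : ℝ,
      (u : ℂ) + ε * Complex.I - (v : ℂ) = ((u - v : ℝ) : ℂ) + ε * Complex.I := fun u ε v => by
    push_cast; ring
  have hfu : ∀ u ε : ℝ, f (u + ε * Complex.I) = ((u : ℂ) + ε * Complex.I) ^ c *
      (((u - x : ℝ) : ℂ) + ε * Complex.I) ^ c * (((u - 1 : ℝ) : ℂ) + ε * Complex.I) ^ c :=
    fun u ε => by simp only [hf, hshift]
  have hdiff : DifferentiableOn ℂ f {z | 0 < z.im} := fun z hz => by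
    have h : ∀ v : ℝ, DifferentiableAt ℂ (fun z : ℂ => (z - (v : ℂ)) ^ c) z := fun v =>
      DifferentiableAt.cpow (by fun_prop) (by fun_prop) (Or.inr (by
        have : 0 < z.im := hz
        simpa using this.ne'))
    have h0 := h 0
    simp only [Complex.ofReal_zero, sub_zero] at h0
    exact ((h0.mul (h x)).mul (h 1)).differentiableWithinAt
  have hbase : ∀ u ε : ℝ, u ≠ 0 → ‖((u : ℂ) + ε * Complex.I) ^ c‖ ≤ |u| ^ (-a) := fun u ε hu => by
    rw [Complex.norm_cpow_real]
    refine Real.rpow_le_rpow_of_nonpos (abs_pos.2 hu) ?_ (by linarith)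
    simpa using Complex.abs_re_le_norm ((u : ℂ) + ε * Complex.I)
  have hbase' : ∀ u ε : ℝ, 0 < ε → ‖((u : ℂ) + ε * Complex.I) ^ c‖ ≤ ε ^ (-a) :=
    fun u ε hε => by
      rw [Complex.norm_cpow_real]
      refine Real.rpow_le_rpow_of_nonpos hε ?_ (by linarith)
      simpa [abs_of_pos hε] using Complex.abs_im_le_norm ((u : ℂ) + ε * Complex.I)
  have hzero : ∫ u, g u = 0 := by
    refine integral_boundary_eq_zero (f := f) (D := modulus a x) (S := {0, x, 1}) (by simp)
      hdiff hint ?_ ?_ ?_ ?_ ?_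
    · intro u hu ε hε
      simp only [mem_insert_iff, mem_singleton_iff, not_or] at hu
      rw [hfu, norm_mul, norm_mul, modulus]
      gcongr
      · exact hbase _ _ hu.1
      · exact hbase _ _ (sub_ne_zero.2 hu.2.1)
      · exact hbase _ _ (sub_ne_zero.2 hu.2.2)
    · exact tendsto_modulus ha x fun v =>
        tendsto_abs_atTop_atTop.comp (tendsto_atTop_add_const_right _ (-v) tendsto_id)
    · exact tendsto_modulus ha x fun v =>
        tendsto_abs_atBot_atTop.comp (tendsto_atBot_add_const_right _ (-v) tendsto_id)
    · intro u
      have h := tendsto_rpow_neg_atTop ha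
      refine squeeze_zero_norm' (a := fun ε : ℝ => ε ^ (-a) * ε ^ (-a) * ε ^ (-a)) ?_
        (by simpa using (h.mul h).mul h)
      filter_upwards [eventually_gt_atTop 0] with ε hε
      rw [hfu, norm_mul, norm_mul]
      gcongr <;> exact hbase' _ _ hε
    · intro u hu
      simp only [mem_insert_iff, mem_singleton_iff, not_or] at hu
      simp only [hfu]
      exact ((tendsto_cpow_from_above hu.1 c).mul
        (tendsto_cpow_from_above (sub_ne_zero.2 hu.2.1) c)).mul
        (tendsto_cpow_from_above (sub_ne_zero.2 hu.2.2) c)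
  have hpiece : ∀ (s : Set ℝ) (w : ℂ), MeasurableSet s →
      (∀ u ∈ s, g u = w * ((modulus a x u : ℝ) : ℂ)) →
      ∫ u in s, g u = w * ((∫ u in s, modulus a x u : ℝ) : ℂ) := fun s w hs h => by
    rw [setIntegral_congr_fun hs h, integral_const_mul, integral_complex_ofReal]
  have h1 : ∀ u ∈ Iio (0 : ℝ), g u = E ^ 3 * ((modulus a x u : ℝ) : ℂ) := fun u hu => by
    have hu' : u < 0 := hu
    simp only [hg, hc, modulus]
    rw [ofReal_cpow_neg_exponent a hu', ofReal_cpow_neg_exponent a (by linarith [hx.1]),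
      ofReal_cpow_neg_exponent a (by linarith), hE, hc]
    push_cast; ring
  have h2 : ∀ u ∈ Ioo 0 x, g u = E ^ 2 * ((modulus a x u : ℝ) : ℂ) := fun u hu => by
    simp only [hg, hc, modulus]
    rw [ofReal_cpow_abs a hu.1.le, ofReal_cpow_neg_exponent a (by linarith [hu.2]),
      ofReal_cpow_neg_exponent a (by linarith [hu.2, hx.2]), hE, hc]
    push_cast; ring
  have h3 : ∀ u ∈ Ioo x 1, g u = E * ((modulus a x u : ℝ) : ℂ) := fun u hu => by
    simp only [hg, hc, modulus]
    rw [ofReal_cpow_abs a (by linarith [hu.1, hx.1]), ofReal_cpow_abs a (by linarith [hu.1]),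
      ofReal_cpow_neg_exponent a (by linarith [hu.2]), hE, hc]
    push_cast; ring
  have h4 : ∀ u ∈ Ioi (1 : ℝ), g u = 1 * ((modulus a x u : ℝ) : ℂ) := fun u hu => by
    have hu' : 1 < u := hu
    simp only [hg, hc, modulus]
    rw [ofReal_cpow_abs a (by linarith), ofReal_cpow_abs a (by linarith [hx.2]),
      ofReal_cpow_abs a (by linarith)]
    push_cast; ring
  have hgint : Integrable g := by
    refine hint.mono' (Measurable.aestronglyMeasurable (by fun_prop))
      (Eventually.of_forall fun u => ?_)
    simp only [hg, hc, modulus, norm_mul, Complex.norm_cpow_real, Complex.norm_real,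
      Real.norm_eq_abs]
    rfl
  rw [integral_split hx hgint, hpiece _ _ measurableSet_Iio h1, hpiece _ _ measurableSet_Ioo h2,
    hpiece _ _ measurableSet_Ioo h3, hpiece _ _ measurableSet_Ioi h4] at hzero
  -- The factor e^(3πia) makes the coefficient of the integral over (-∞,0) equal to 1, so that this
  -- integral drops out of the imaginary part.
  have hEn : ∀ n : ℕ, Complex.exp ((3 * (Real.pi * a) : ℝ) * Complex.I) * E ^ n =
      Complex.exp (((3 - n) * (Real.pi * a) : ℝ) * Complex.I) := fun n => by
    rw [hE, ← Complex.exp_nat_mul, ← Complex.exp_add, hc]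
    congr 1; push_cast; ring
  have him := congrArg Complex.im
    (congrArg (Complex.exp ((3 * (Real.pi * a) : ℝ) * Complex.I) * ·) hzero)
  have e3 := hEn 3
  have e2 := hEn 2
  have e1 := hEn 1
  norm_num at e3 e2 e1
  simp only [mul_add, ← mul_assoc, mul_zero, mul_one, Complex.add_im, Complex.zero_im] at him
  push_cast at him
  simp only [← mul_assoc] at e1 e2 e3 him
  rw [e3, e2, e1] at him
  have t1 : (Real.pi : ℂ) * a * Complex.I = ((Real.pi * a : ℝ) : ℂ) * Complex.I := by
    push_cast; rfl
  have t2 : (2 : ℂ) * Real.pi * a * Complex.I = ((2 * (Real.pi * a) : ℝ) : ℂ) * Complex.I := by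
    push_cast; ring
  have t3 : (3 : ℂ) * Real.pi * a * Complex.I = ((3 * (Real.pi * a) : ℝ) : ℂ) * Complex.I := by
    push_cast; ring
  rw [t1, t2, t3] at him
  simp only [one_mul, Complex.im_mul_ofReal, Complex.exp_ofReal_mul_I_im, Complex.ofReal_im]
    at him
  linarith

/-! ### Trigonometry of the angle π/(k+2) and the matrix `R13` -/

theorem expo_lt_one (k : ℕ) : expo k < 1 := by
  rw [expo, div_lt_one (by positivity)]; linarith

/-- Used to obtain 3a > 1, for convergence at infinity, and 2a > 1, for independence of the blocks.
-/
theorem two_thirds_lt_expo {k : ℕ} (hk : 2 ≤ k) : 2 / 3 < expo k := by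
  have : (2 : ℝ) ≤ k := by exact_mod_cast hk
  rw [expo, div_lt_div_iff₀ (by norm_num) (by positivity)]; linarith

theorem pi_mul_expo (k : ℕ) : Real.pi * expo k = Real.pi - Real.pi / ((k : ℝ) + 2) := by
  rw [expo]; field_simp; ring

/-- The angle `π/(k+2)`. -/
noncomputable def baseAngle (k : ℕ) : ℝ := Real.pi / ((k : ℝ) + 2)

theorem baseAngle_pos (k : ℕ) : 0 < baseAngle k := div_pos Real.pi_pos (by positivity)

theorem baseAngle_le {k : ℕ} (hk : 2 ≤ k) : baseAngle k ≤ Real.pi / 4 := by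
  have : (2 : ℝ) ≤ k := by exact_mod_cast hk
  exact div_le_div_of_nonneg_left Real.pi_pos.le (by norm_num) (by linarith)

theorem half_lt_cos_baseAngle {k : ℕ} (hk : 2 ≤ k) : 1 / 2 < Real.cos (baseAngle k) := by
  rw [← Real.cos_pi_div_three]
  have := baseAngle_le hk
  have := baseAngle_pos k
  exact Real.cos_lt_cos_of_nonneg_of_le_pi_div_two (by linarith) (by linarith [Real.pi_pos])
    (by linarith [Real.pi_pos])

theorem sin_baseAngle_pos {k : ℕ} (hk : 2 ≤ k) : 0 < Real.sin (baseAngle k) :=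
  Real.sin_pos_of_pos_of_lt_pi (baseAngle_pos k) (by linarith [baseAngle_le hk, Real.pi_pos])

theorem sin_two_baseAngle_pos {k : ℕ} (hk : 2 ≤ k) : 0 < Real.sin (2 * baseAngle k) :=
  Real.sin_pos_of_pos_of_lt_pi (by linarith [baseAngle_pos k])
    (by linarith [baseAngle_le hk, Real.pi_pos])

theorem sin_three_baseAngle_pos {k : ℕ} (hk : 2 ≤ k) : 0 < Real.sin (3 * baseAngle k) :=
  Real.sin_pos_of_pos_of_lt_pi (by linarith [baseAngle_pos k])
    (by linarith [baseAngle_le hk, Real.pi_pos])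

theorem cosine_value_mem {k : ℕ} (hk : 2 ≤ k) :
    1 / 2 * (Real.cos (Real.pi / ((k : ℝ) + 2)))⁻¹ ∈ Ioo (0 : ℝ) 1 := by
  have h : 1 / 2 < Real.cos (Real.pi / ((k : ℝ) + 2)) := half_lt_cos_baseAngle hk
  have h0 : 0 < Real.cos (Real.pi / ((k : ℝ) + 2)) := by linarith
  refine ⟨by positivity, ?_⟩
  rw [← div_eq_mul_inv, div_lt_one h0]
  exact h

theorem cos_theta {k : ℕ} (hk : 2 ≤ k) :
    Real.cos (theta k) = 1 / 2 * (Real.cos (Real.pi / ((k : ℝ) + 2)))⁻¹ :=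
  Real.cos_arccos (by linarith [(cosine_value_mem hk).1]) (cosine_value_mem hk).2.le

theorem theta_mem {k : ℕ} (hk : 2 ≤ k) : theta k ∈ Ioo 0 (Real.pi / 2) :=
  ⟨Real.arccos_pos.2 (cosine_value_mem hk).2,
    Real.arccos_lt_pi_div_two.2 (cosine_value_mem hk).1⟩

theorem sin_theta_pos {k : ℕ} (hk : 2 ≤ k) : 0 < Real.sin (theta k) :=
  Real.sin_pos_of_pos_of_lt_pi (theta_mem hk).1 (by linarith [(theta_mem hk).2, Real.pi_pos])

theorem cos_theta_mul {k : ℕ} (hk : 2 ≤ k) :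
    Real.cos (theta k) * Real.sin (2 * baseAngle k) = Real.sin (baseAngle k) := by
  have h : 0 < Real.cos (baseAngle k) := by linarith [half_lt_cos_baseAngle hk]
  rw [cos_theta hk, Real.sin_two_mul]
  change 1 / 2 * (Real.cos (baseAngle k))⁻¹ * _ = _
  field_simp

/-- With cos θ = sin α / sin 2α, the claim reduces to sin² 2α - sin² α = sin α sin 3α. -/
theorem sin_theta_mul_sq {k : ℕ} (hk : 2 ≤ k) :
    (Real.sin (theta k) * Real.sin (2 * baseAngle k)) ^ 2 =
      Real.sin (baseAngle k) * Real.sin (3 * baseAngle k) := by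
  have h1 := cos_theta_mul hk
  have h2 := Real.sin_sq_add_cos_sq (theta k)
  have h3 := Real.sin_sq_add_cos_sq (baseAngle k)
  have h4 : (Real.sin (theta k) * Real.sin (2 * baseAngle k)) ^ 2 =
      Real.sin (2 * baseAngle k) ^ 2 - Real.sin (baseAngle k) ^ 2 := by
    rw [← h1]; linear_combination Real.sin (2 * baseAngle k) ^ 2 * h2
  rw [h4, Real.sin_two_mul, Real.sin_three_mul]
  linear_combination 4 * Real.sin (baseAngle k) ^ 2 * h3

theorem R13_isSymm (k : ℕ) : (R13 k).IsSymm := by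
  ext i j; fin_cases i <;> fin_cases j <;> rfl

theorem R13_mul_self (k : ℕ) : R13 k * R13 k = 1 := by
  have h := Real.sin_sq_add_cos_sq (theta k)
  ext i j
  fin_cases i <;> fin_cases j <;> simp [R13, Matrix.mul_apply, Fin.sum_univ_two] <;>
    linarith

/-! ### The exchange x → 1-x -/

theorem integrableOn_integrand₁ {k : ℕ} (hk : 2 ≤ k) {x : ℝ} (hx : x ∈ Ioo (0 : ℝ) 1) :
    IntegrableOn (integrand₁ k x) (Ioo 0 x) :=
  integrableOn_near (by linarith [two_thirds_lt_expo hk]) (expo_lt_one k) hx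

theorem integrableOn_integrand₂ {k : ℕ} (hk : 2 ≤ k) {x : ℝ} (hx : x ∈ Ioo (0 : ℝ) 1) :
    IntegrableOn (integrand₂ k x) (Ioi 1) :=
  integrableOn_tail (expo_lt_one k) (by linarith [two_thirds_lt_expo hk]) hx

theorem one_sub_mem_Ioo {x : ℝ} (hx : x ∈ Ioo (0 : ℝ) 1) : 1 - x ∈ Ioo (0 : ℝ) 1 :=
  ⟨by linarith [hx.2], by linarith [hx.1]⟩

theorem contourIntegral_one_sub {k : ℕ} (hk : 2 ≤ k) {x : ℝ} (hx : x ∈ Ioo (0 : ℝ) 1) :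
    Real.sin (2 * baseAngle k) * contourIntegral k (1 - x) 0 =
      Real.sin (baseAngle k) * contourIntegral k x 0 +
        Real.sin (3 * baseAngle k) * contourIntegral k x 1 := by
  have hrel := contour_relation (a := expo k) (by linarith [two_thirds_lt_expo hk]) hx
    (integrable_modulus (fun x hx => integrableOn_integrand₁ hk hx)
      (fun x hx => integrableOn_integrand₂ hk hx) hx)
  have h1 : ∫ u in Ioo 0 x, modulus (expo k) x u = contourIntegral k x 0 :=
    setIntegral_congr_fun measurableSet_Ioo fun w hw => modulus_near _ hx hw
  have h2 : ∫ u in Ioi 1, modulus (expo k) x u = contourIntegral k x 1 :=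
    setIntegral_congr_fun measurableSet_Ioi fun w hw => modulus_tail _ hx hw
  have h3 : ∫ u in Ioo x 1, modulus (expo k) x u = contourIntegral k (1 - x) 0 := by
    rw [← integral_comp_one_sub, preimage_const_sub_Ioo, sub_self]
    refine setIntegral_congr_fun measurableSet_Ioo fun w hw => ?_
    simp only [modulus_one_sub]
    exact modulus_near _ (one_sub_mem_Ioo hx) hw
  rw [h1, h2, h3, pi_mul_expo] at hrel
  change Real.sin (Real.pi - baseAngle k) * _ + Real.sin (2 * (Real.pi - baseAngle k)) * _ +
    Real.sin (3 * (Real.pi - baseAngle k)) * _ = 0 at hrel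
  have e2 : Real.sin (2 * (Real.pi - baseAngle k)) = -Real.sin (2 * baseAngle k) := by
    rw [show 2 * (Real.pi - baseAngle k) = -(2 * baseAngle k) + 2 * Real.pi by ring,
      Real.sin_add_two_pi, Real.sin_neg]
  have e3 : Real.sin (3 * (Real.pi - baseAngle k)) = Real.sin (3 * baseAngle k) := by
    rw [show 3 * (Real.pi - baseAngle k) = Real.pi - 3 * baseAngle k + 2 * Real.pi by ring,
      Real.sin_add_two_pi, Real.sin_pi_sub]
  rw [Real.sin_pi_sub, e2, e3] at hrel
  linarith

theorem normConst_zero (k : ℕ) (C : ℝ) : normConst k C 0 = C * Real.sin (baseAngle k) := rfl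

theorem normConst_one (k : ℕ) (C : ℝ) : normConst k C 1 = C * Real.sin (3 * baseAngle k) := by
  change C * Real.sin (3 * Real.pi / _) = C * Real.sin (3 * (Real.pi / _))
  rw [mul_div_assoc]

theorem sqrt_normConst_pos {k : ℕ} (hk : 2 ≤ k) {C : ℝ} (hC : 0 < C) (μ : Fin 2) :
    0 < √(normConst k C μ) := by
  refine Real.sqrt_pos.2 ?_
  fin_cases μ
  · exact (normConst_zero k C).symm ▸ mul_pos hC (sin_baseAngle_pos hk)
  · exact (normConst_one k C).symm ▸ mul_pos hC (sin_three_baseAngle_pos hk)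

/-- The ratio of the normalization constants enters here: it turns the off-diagonal coefficient sin
3α / sin 2α of the contour relation into sin θ. -/
theorem sin_theta_mul_sqrt_normConst {k : ℕ} (hk : 2 ≤ k) {C : ℝ} (hC : 0 < C) :
    Real.sin (theta k) * Real.sin (2 * baseAngle k) * √(normConst k C 1) =
      √(normConst k C 0) * Real.sin (3 * baseAngle k) := by
  have h0 := sin_theta_pos hk
  have h1 := sin_baseAngle_pos hk
  have h2 := sin_two_baseAngle_pos hk
  have h3 := sin_three_baseAngle_pos hk
  rw [← sq_eq_sq₀ (by positivity) (by positivity), mul_pow, sin_theta_mul_sq hk, mul_pow,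
    Real.sq_sqrt (by rw [normConst_one]; positivity),
    Real.sq_sqrt (by rw [normConst_zero]; positivity), normConst_one, normConst_zero]
  ring

theorem block_zero_one_sub {k : ℕ} (hk : 2 ≤ k) {C : ℝ} (hC : 0 < C) {x : ℝ}
    (hx : x ∈ Ioo (0 : ℝ) 1) :
    block k C 0 (1 - x) =
      Real.cos (theta k) * block k C 0 x + Real.sin (theta k) * block k C 1 x := by
  have h := contourIntegral_one_sub hk hx
  have h2 := sin_two_baseAngle_pos hk
  have hc := cos_theta_mul hk
  have hs := sin_theta_mul_sqrt_normConst hk hC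
  rw [block, block, block, sub_sub_cancel, mul_comm (1 - x) x]
  refine mul_left_cancel₀ h2.ne' ?_
  linear_combination √(normConst k C 0) * (x * (1 - x)) ^ (expo k / 2) * h -
    √(normConst k C 0) * (x * (1 - x)) ^ (expo k / 2) * contourIntegral k x 0 * hc -
    (x * (1 - x)) ^ (expo k / 2) * contourIntegral k x 1 * hs

theorem block_one_sub {k : ℕ} (hk : 2 ≤ k) {C : ℝ} (hC : 0 < C) {x : ℝ}
    (hx : x ∈ Ioo (0 : ℝ) 1) (μ : Fin 2) :
    block k C μ (1 - x) = ∑ ν, R13 k μ ν * block k C ν x := by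
  have h0 := block_zero_one_sub hk hC hx
  rw [Fin.sum_univ_two]
  fin_cases μ
  · simpa [R13] using h0
  · have h1 := block_zero_one_sub hk hC (one_sub_mem_Ioo hx)
    rw [sub_sub_cancel, h0] at h1
    have hsc := Real.sin_sq_add_cos_sq (theta k)
    refine mul_left_cancel₀ (sin_theta_pos hk).ne' ?_
    simp only [R13, Fin.mk_one, Matrix.of_apply, Matrix.cons_val', Matrix.cons_val_zero,
      Matrix.cons_val_one, Matrix.cons_val_fin_one]
    linear_combination -h1 - block k C 0 x * hsc

theorem crossRatio_swap {η : Fin 4 → ℝ} (h02 : η 0 ≠ η 2) (h13 : η 1 ≠ η 3) :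
    crossRatio (fun l => η (Equiv.swap 0 2 l)) = 1 - crossRatio η := by
  have e0 : Equiv.swap (0 : Fin 4) 2 0 = 2 := by decide
  have e1 : Equiv.swap (0 : Fin 4) 2 1 = 1 := by decide
  have e2 : Equiv.swap (0 : Fin 4) 2 2 = 0 := by decide
  have e3 : Equiv.swap (0 : Fin 4) 2 3 = 3 := by decide
  have h1 := sub_ne_zero.2 h02
  have h2 := sub_ne_zero.2 h13
  have h3 := sub_ne_zero.2 h02.symm
  simp only [crossRatio, e0, e1, e2, e3]
  rw [← neg_sub (η 0) (η 2)]
  field_simp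
  ring

theorem crossRatio_mem {η : Fin 4 → ℝ} (hη : StrictMono η) : crossRatio η ∈ Ioo (0 : ℝ) 1 := by
  have h01 := sub_neg.2 (hη (show (0 : Fin 4) < 1 by decide))
  have h12 := sub_neg.2 (hη (show (1 : Fin 4) < 2 by decide))
  have h23 := sub_neg.2 (hη (show (2 : Fin 4) < 3 by decide))
  have hQ : 0 < (η 0 - η 2) * (η 1 - η 3) := mul_pos_of_neg_of_neg (by linarith) (by linarith)
  refine ⟨div_pos (mul_pos_of_neg_of_neg h01 h23) hQ, (div_lt_one hQ).2 ?_⟩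
  -- The difference of denominator and numerator is (η 0 - η 3)(η 1 - η 2) > 0.
  nlinarith

theorem fullBlock_swap {k : ℕ} (hk : 2 ≤ k) {C : ℝ} (hC : 0 < C) {η : Fin 4 → ℝ}
    (h02 : η 0 ≠ η 2) (h13 : η 1 ≠ η 3) (hη : crossRatio η ∈ Ioo (0 : ℝ) 1) (μ : Fin 2) :
    fullBlock k C μ (fun l => η (Equiv.swap 0 2 l)) =
      ∑ ν, R13 k μ ν * fullBlock k C ν η := by
  simp only [fullBlock]
  rw [crossRatio_swap h02 h13, block_one_sub hk hC hη, Finset.mul_sum]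
  refine Finset.sum_congr rfl fun ν _ => ?_
  have e0 : Equiv.swap (0 : Fin 4) 2 0 = 2 := by decide
  have e1 : Equiv.swap (0 : Fin 4) 2 1 = 1 := by decide
  have e2 : Equiv.swap (0 : Fin 4) 2 2 = 0 := by decide
  have e3 : Equiv.swap (0 : Fin 4) 2 3 = 3 := by decide
  rw [e0, e1, e2, e3, abs_mul, abs_mul, abs_sub_comm (η 2)]
  ring

/-! ### Complex Euler integrals and independence of the blocks -/

/-- The Euler integral of the first block. -/
noncomputable def euler₁ (a : ℝ) : ℂ → ℂ :=
  eulerIntegral (volume.restrict (Ioo 0 1)) (betaDensity a) id a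

/-- The Euler integral of the second block. -/
noncomputable def euler₂ (a : ℝ) : ℂ → ℂ :=
  eulerIntegral (volume.restrict (Ioi 1)) (tailDensity a) Inv.inv a

theorem analyticAt_euler₁ {a : ℝ} (ha : a < 1) {x : ℂ} (hx : 1 - x ∈ Complex.slitPlane) :
    AnalyticAt ℂ (euler₁ a) x :=
  analyticAt_eulerIntegral a (integrableOn_betaDensity ha) measurable_id ae_mem_Icc_of_Ioo hx

theorem analyticAt_euler₂ {a : ℝ} (ha : a < 1) (ha3 : 1 < 3 * a) {x : ℂ}
    (hx : 1 - x ∈ Complex.slitPlane) : AnalyticAt ℂ (euler₂ a) x :=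
  analyticAt_eulerIntegral a (integrableOn_tailDensity ha ha3) measurable_inv ae_inv_mem_Icc hx

theorem euler₁_ofReal (a : ℝ) {x : ℝ} (hx : x < 1) :
    euler₁ a x =
      (eulerReal (volume.restrict (Ioo 0 1)) (betaDensity a) id a x : ℂ) :=
  eulerIntegral_ofReal a ae_mem_Icc_of_Ioo hx

theorem euler₂_ofReal (a : ℝ) {x : ℝ} (hx : x < 1) :
    euler₂ a x =
      (eulerReal (volume.restrict (Ioi 1)) (tailDensity a) Inv.inv a x : ℂ) :=
  eulerIntegral_ofReal a ae_inv_mem_Icc hx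

theorem euler₁_pfaff (a : ℝ) {x : ℝ} (hx : x ∈ Ioo (0 : ℝ) 1) :
    euler₁ a ((x / (x - 1) : ℝ) : ℂ) = (((1 - x) ^ a : ℝ) : ℂ) * euler₁ a x := by
  have hx' : x / (x - 1) < 1 := by
    rw [div_lt_one_of_neg (by linarith [hx.2])]; linarith
  rw [euler₁_ofReal a hx.2, euler₁_ofReal a hx', eulerReal_beta_pfaff hx.2]
  push_cast; rfl

theorem euler₂_pfaff (a : ℝ) {x : ℝ} (hx : x ∈ Ioo (0 : ℝ) 1) :
    euler₂ a ((x / (x - 1) : ℝ) : ℂ) = (((1 - x) ^ (3 * a - 1) : ℝ) : ℂ) * euler₂ a x := by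
  have hx' : x / (x - 1) < 1 := by
    rw [div_lt_one_of_neg (by linarith [hx.2])]; linarith
  rw [euler₂_ofReal a hx.2, euler₂_ofReal a hx', eulerReal_tail_pfaff hx.2]
  push_cast; rfl

theorem contourIntegral_zero (k : ℕ) {x : ℝ} (hx : x ∈ Ioo (0 : ℝ) 1) :
    (contourIntegral k x 0 : ℂ) = ((x ^ (1 - 2 * expo k) : ℝ) : ℂ) * euler₁ (expo k) x := by
  rw [euler₁_ofReal _ hx.2, ← Complex.ofReal_mul, ← integral_near hx]
  rfl

theorem contourIntegral_one (k : ℕ) {x : ℝ} (hx : x ∈ Ioo (0 : ℝ) 1) :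
    (contourIntegral k x 1 : ℂ) = euler₂ (expo k) x := by
  rw [euler₂_ofReal _ hx.2, ← integral_tail hx.2]
  rfl

theorem euler₁_zero_ne {a : ℝ} (ha0 : 0 ≤ a) (ha : a < 1) : euler₁ a 0 ≠ 0 := by
  have h := euler₁_ofReal a (x := 0) one_pos
  rw [Complex.ofReal_zero] at h
  rw [h, Complex.ofReal_ne_zero]
  refine (eulerReal_pos (fun h => ?_) (integrable_euler ha0 (integrableOn_betaDensity ha)
    measurable_id ae_mem_Icc_of_Ioo le_rfl one_pos) ?_ ae_mem_Icc_of_Ioo one_pos).ne'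
  · simp [Measure.restrict_eq_zero] at h
  · exact (ae_restrict_mem measurableSet_Ioo).mono fun t ht =>
      Real.rpow_pos_of_pos (mul_pos ht.1 (by linarith [ht.2])) _

theorem euler₂_ne {a x : ℝ} (ha : a < 1) (ha3 : 1 < 3 * a) (hx : x ∈ Ioo (0 : ℝ) 1) :
    euler₂ a x ≠ 0 := by
  rw [euler₂_ofReal a hx.2, Complex.ofReal_ne_zero]
  refine (eulerReal_pos (fun h => ?_) (integrable_euler (by linarith)
    (integrableOn_tailDensity ha ha3) measurable_inv ae_inv_mem_Icc hx.1.le hx.2) ?_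
    ae_inv_mem_Icc hx.2).ne'
  · simp [Measure.restrict_eq_zero] at h
  · refine (ae_restrict_mem measurableSet_Ioi).mono fun w hw => ?_
    have hw' : 1 < w := hw
    exact Real.rpow_pos_of_pos (mul_pos (by positivity) (by linarith)) _

/-- After multiplication by x^(2a-1) and removal of the common factor, a linear relation couples two
functions continuous at 0, the second carrying the factor x^(2a-1). Letting x → 0 kills `g 0`, since
the first Euler integral is nonzero there; evaluation at 1/2 then kills `g 1`. -/
theorem linearIndependent_block {k : ℕ} (hk : 2 ≤ k) {C : ℝ} (hC : 0 < C) :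
    LinearIndependent ℂ (fun (μ : Fin 2) (x : Ioo (0 : ℝ) 1) => (block k C μ x : ℂ)) := by
  have ha := expo_lt_one k
  have ha' := two_thirds_lt_expo hk
  rw [Fintype.linearIndependent_iff]
  intro g hg
  have hN := fun μ => (Complex.ofReal_ne_zero.2 (sqrt_normConst_pos hk hC μ).ne')
  have hrel : ∀ x ∈ Ioo (0 : ℝ) 1, g 0 * √(normConst k C 0) * euler₁ (expo k) x +
      g 1 * √(normConst k C 1) * (((x ^ (2 * expo k - 1) : ℝ) : ℂ) * euler₂ (expo k) x) = 0 := by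
    intro x hx
    have h := congrFun hg ⟨x, hx⟩
    simp only [Fin.sum_univ_two, Pi.add_apply, Pi.smul_apply, smul_eq_mul, Pi.zero_apply, block,
      Complex.ofReal_mul, contourIntegral_zero k hx, contourIntegral_one k hx] at h
    have hpos : 0 < (x * (1 - x)) ^ (expo k / 2) :=
      Real.rpow_pos_of_pos (mul_pos hx.1 (by linarith [hx.2])) _
    have hinv : ((x ^ (2 * expo k - 1) : ℝ) : ℂ) * ((x ^ (1 - 2 * expo k) : ℝ) : ℂ) = 1 := by
      rw [← Complex.ofReal_mul, ← Real.rpow_add hx.1]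
      norm_num
    refine mul_left_cancel₀ (Complex.ofReal_ne_zero.2 hpos.ne') ?_
    linear_combination ((x ^ (2 * expo k - 1) : ℝ) : ℂ) * h -
      ((x * (1 - x)) ^ (expo k / 2) : ℝ) * (g 0 * √(normConst k C 0) * euler₁ (expo k) x) * hinv
  have hcoe : Tendsto (fun x : ℝ => (x : ℂ)) (𝓝[>] 0) (𝓝 0) := by
    simpa using (Complex.continuous_ofReal.tendsto 0).mono_left nhdsWithin_le_nhds
  have h0 : (1 : ℂ) - 0 ∈ Complex.slitPlane := by simp
  have hl1 := (analyticAt_euler₁ ha h0).continuousAt.tendsto.comp hcoe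
  have hl2 := (analyticAt_euler₂ ha (by linarith) h0).continuousAt.tendsto.comp hcoe
  have hpow : Tendsto (fun x : ℝ => ((x ^ (2 * expo k - 1) : ℝ) : ℂ)) (𝓝[>] 0) (𝓝 0) := by
    have h := ((Real.continuousAt_rpow_const 0 (2 * expo k - 1)
      (Or.inr (by linarith))).tendsto).mono_left (nhdsWithin_le_nhds (s := Ioi 0))
    rw [Real.zero_rpow (by linarith)] at h
    simpa [Function.comp_def] using (Complex.continuous_ofReal.tendsto 0).comp h
  have hlim := (hl1.const_mul (g 0 * √(normConst k C 0))).add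
    ((hpow.mul hl2).const_mul (g 1 * √(normConst k C 1)))
  have hev : ∀ᶠ x : ℝ in 𝓝[>] 0, x ∈ Ioo (0 : ℝ) 1 := Ioo_mem_nhdsGT one_pos
  have hg0 : g 0 = 0 := by
    have h := tendsto_nhds_unique (hlim.congr' (hev.mono fun x hx => hrel x hx))
      tendsto_const_nhds
    simpa [hN 0, euler₁_zero_ne (by linarith) ha] using h
  have hg1 : g 1 = 0 := by
    have hx : (1 / 2 : ℝ) ∈ Ioo (0 : ℝ) 1 := by norm_num
    have h := hrel _ hx
    have hp : (((1 / 2 : ℝ) ^ (2 * expo k - 1) : ℝ) : ℂ) ≠ 0 :=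
      Complex.ofReal_ne_zero.2 (Real.rpow_pos_of_pos (by norm_num) _).ne'
    rw [hg0, zero_mul, zero_mul, zero_add] at h
    exact (mul_eq_zero.1 ((mul_eq_zero.1 h).resolve_right
      (mul_ne_zero hp (euler₂_ne ha (by linarith) hx)))).resolve_right (hN 1)
  intro i
  fin_cases i
  exacts [hg0, hg1]

/-! ### Analytic continuation along the half-turn -/

/-- Both arguments lie strictly between -π/2 and π/2, so their sum cannot reach ±π. -/
theorem mul_mem_slitPlane_of_re_pos {u v : ℂ} (hu : 0 < u.re) (hv : 0 < v.re) :
    u * v ∈ Complex.slitPlane := by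
  rw [Complex.mem_slitPlane_iff]
  by_contra! h
  obtain ⟨h1, h2⟩ := h
  rw [Complex.mul_re] at h1
  rw [Complex.mul_im] at h2
  have h3 : u.re * (u.re * v.re - u.im * v.im) = v.re * (u.re ^ 2 + u.im ^ 2) := by
    linear_combination -u.im * h2
  have h4 : 0 < v.re * (u.re ^ 2 + u.im ^ 2) := by positivity
  nlinarith

theorem one_add_re_pos {s : ℂ} (hs : ‖s‖ < 1) : 0 < (1 + s).re := by
  have := (abs_le.1 (Complex.abs_re_le_norm s)).1
  simp only [Complex.add_re, Complex.one_re]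
  linarith

/-- The Cayley transform maps the unit disc to the right half-plane: the real part has the sign of 1
- |s|². -/
theorem cayley_re_pos {s : ℂ} (hs : ‖s‖ < 1) : 0 < ((1 + s) / (1 + -s)).re := by
  have h1 : 1 + -s ≠ 0 := fun h => by
    have := one_add_re_pos (s := -s) (by simpa using hs)
    rw [h] at this
    simp at this
  have h2 : s.re * s.re + s.im * s.im < 1 := by
    rw [← Complex.normSq_apply, Complex.normSq_eq_norm_sq]
    nlinarith [norm_nonneg s]
  have h3 := Complex.normSq_pos.2 h1
  rw [Complex.div_re, ← add_div]
  refine div_pos ?_ h3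
  simp only [Complex.add_re, Complex.one_re, Complex.neg_re, Complex.add_im, Complex.one_im,
    Complex.neg_im, zero_add]
  nlinarith

/-- The logarithm is additive here because |θ| + |arg B| < π. -/
theorem rotate_cpow {B : ℂ} (hB : 0 < B.re) {θ : ℝ} (hθ : |θ| < Real.pi / 2) (c : ℂ) :
    (Complex.exp (θ * Complex.I) * B) ^ c = Complex.exp (θ * Complex.I * c) * B ^ c := by
  have hB0 : B ≠ 0 := fun h => by simp [h] at hB
  have hlog : Complex.log (Complex.exp (θ * Complex.I) * B) = θ * Complex.I + Complex.log B := by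
    have harg := Complex.abs_arg_lt_pi_div_two_iff.2 (Or.inl hB)
    rw [abs_lt] at hθ harg
    conv_lhs => rw [← Complex.exp_log hB0, ← Complex.exp_add]
    apply Complex.log_exp <;>
    · simp only [Complex.add_im, Complex.log_im, Complex.mul_im, Complex.ofReal_re,
        Complex.ofReal_im, Complex.I_re, Complex.I_im]
      linarith
  rw [Complex.cpow_def_of_ne_zero (mul_ne_zero (Complex.exp_ne_zero _) hB0),
    Complex.cpow_def_of_ne_zero hB0, hlog, ← Complex.exp_add]
  congr 1; ring

/-- The numerator of the anharmonic ratio. -/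
def ratioNum {K : Type*} [CommRing K] (y : Fin 4 → K) : K := (y 0 - y 1) * (y 2 - y 3)

/-- The denominator of the anharmonic ratio. -/
def ratioDen {K : Type*} [CommRing K] (y : Fin 4 → K) : K := (y 0 - y 2) * (y 1 - y 3)

theorem ratioNum_ofReal (y : Fin 4 → ℝ) :
    ratioNum (fun l => (y l : ℂ)) = ((ratioNum y : ℝ) : ℂ) := by
  simp [ratioNum]

theorem ratioDen_ofReal (y : Fin 4 → ℝ) :
    ratioDen (fun l => (y l : ℂ)) = ((ratioDen y : ℝ) : ℂ) := by
  simp [ratioDen]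

theorem analyticAt_ratioNum (y : Fin 4 → ℂ) : AnalyticAt ℂ (ratioNum (K := ℂ)) y := by
  have h : ∀ i : Fin 4, AnalyticAt ℂ (fun y : Fin 4 → ℂ => y i) y := fun i =>
    (ContinuousLinearMap.proj (R := ℂ) (φ := fun _ : Fin 4 => ℂ) i).analyticAt y
  exact ((h 0).sub (h 1)).mul ((h 2).sub (h 3))

theorem analyticAt_ratioDen (y : Fin 4 → ℂ) : AnalyticAt ℂ (ratioDen (K := ℂ)) y := by
  have h : ∀ i : Fin 4, AnalyticAt ℂ (fun y : Fin 4 → ℂ => y i) y := fun i =>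
    (ContinuousLinearMap.proj (R := ℂ) (φ := fun _ : Fin 4 => ℂ) i).analyticAt y
  exact ((h 0).sub (h 2)).mul ((h 1).sub (h 3))

/-- The branch, at time `t` of the half-turn of the first two positions, of
`P ^ p * Q ^ q * (1 - x) ^ r * G x`, where `x = P / Q` is the anharmonic ratio. The sign `ε` is
that of `P` and `Q` at the start. -/
noncomputable def twistedBranch (ε p q r : ℝ) (G : ℂ → ℂ) (t : ℝ) (y : Fin 4 → ℂ) : ℂ :=
  Complex.exp (Real.pi * t * Complex.I * p) *
    (ε * (Complex.exp (-(Real.pi * t * Complex.I)) * ratioNum y)) ^ (p : ℂ) *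
    (ε * ratioDen y) ^ (q : ℂ) * (1 - ratioNum y / ratioDen y) ^ (r : ℂ) *
    G (ratioNum y / ratioDen y)

/-- The first two positions can be exchanged without meeting the other two. -/
structure IsSeparated (ε : ℝ) (ξ : Fin 4 → ℝ) : Prop where
  den_pos : 0 < ε * ratioDen ξ
  ratio_mem : crossRatio ξ ∈ Ioo (0 : ℝ) 1
  near_third : |(ξ 0 - ξ 1) / 2| < |(ξ 0 + ξ 1) / 2 - ξ 2|
  near_fourth : |(ξ 0 - ξ 1) / 2| < |(ξ 0 + ξ 1) / 2 - ξ 3|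

theorem crossRatio_eq (y : Fin 4 → ℝ) : crossRatio y = ratioNum y / ratioDen y := rfl

theorem num_pos_of_mem {ε : ℝ} {y : Fin 4 → ℝ} (hd : 0 < ε * ratioDen y)
    (hx : crossRatio y ∈ Ioo (0 : ℝ) 1) : 0 < ε * ratioNum y := by
  have hd0 : ratioDen y ≠ 0 := fun h => by simp [h] at hd
  have h := mul_pos hx.1 hd
  rw [crossRatio_eq] at h
  have e : ratioNum y / ratioDen y * (ε * ratioDen y) = ε * ratioNum y := by field_simp
  rwa [e] at h

theorem eventually_separated {ε : ℝ} {ξ : Fin 4 → ℝ} (hd : 0 < ε * ratioDen ξ)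
    (hx : crossRatio ξ ∈ Ioo (0 : ℝ) 1) :
    ∀ᶠ y in 𝓝 ξ, 0 < ε * ratioDen y ∧ crossRatio y ∈ Ioo (0 : ℝ) 1 := by
  have hd0 : ratioDen ξ ≠ 0 := fun h => by simp [h] at hd
  have h1 : Continuous (ratioDen (K := ℝ)) := by unfold ratioDen; fun_prop
  have h2 : Continuous (ratioNum (K := ℝ)) := by unfold ratioNum; fun_prop
  have h3 : ContinuousAt crossRatio ξ := h2.continuousAt.div h1.continuousAt hd0
  exact ((h1.const_mul ε).continuousAt.eventually (lt_mem_nhds hd)).and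
    (h3.eventually (Ioo_mem_nhds hx.1 hx.2))

section path

variable {ε : ℝ} {ξ : Fin 4 → ℝ}

/-- The numerator rotates rigidly, so the power in `twistedBranch` is taken of a quantity that stays
at its initial positive value along the path; all the monodromy sits in the explicit exponential. -/
theorem num_halfTwist (ξ : Fin 4 → ℝ) (t : ℝ) :
    Complex.exp (-(Real.pi * t * Complex.I)) * ratioNum (halfTwist 0 1 ξ t) =
      ((ratioNum ξ : ℝ) : ℂ) := by
  have h : Complex.exp (-(Real.pi * t * Complex.I)) * Complex.exp (Complex.I * Real.pi * t) = 1 := by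
    rw [← Complex.exp_add, ← Complex.exp_zero]; congr 1; ring
  simp only [ratioNum, halfTwist]
  simp
  linear_combination ((ξ 0 : ℂ) - ξ 1) * (ξ 2 - ξ 3) * h

/-- Measured from the midpoint, with z the rotating half-difference, Q = (b+z)(c-z) and Q - P =
(c+z)(b-z). Separation means |z| < |b| and |z| < |c|. Hence Q/(bc) is a product of two factors with
positive real part, and 1-x is a product of two Cayley transforms. -/
theorem path_mem_slitPlane (h : IsSeparated ε ξ) (t : ℝ) :
    (ε : ℂ) * ratioDen (halfTwist 0 1 ξ t) ∈ Complex.slitPlane ∧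
      1 - ratioNum (halfTwist 0 1 ξ t) / ratioDen (halfTwist 0 1 ξ t) ∈ Complex.slitPlane := by
  obtain ⟨hden, hx, hb', hc'⟩ := h
  set b : ℝ := (ξ 0 + ξ 1) / 2 - ξ 2 with hb
  set c : ℝ := (ξ 0 + ξ 1) / 2 - ξ 3 with hc
  set d : ℝ := (ξ 0 - ξ 1) / 2 with hd
  set z : ℂ := Complex.exp (Complex.I * Real.pi * t) * d with hz
  have hb0 : b ≠ 0 := abs_pos.1 ((abs_nonneg d).trans_lt hb')
  have hc0 : c ≠ 0 := abs_pos.1 ((abs_nonneg d).trans_lt hc')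
  have hznorm : ‖z‖ = |d| := by
    rw [hz, norm_mul, Complex.norm_real, Real.norm_eq_abs,
      show Complex.I * Real.pi * t = ((Real.pi * t : ℝ) : ℂ) * Complex.I by push_cast; ring,
      Complex.norm_exp_ofReal_mul_I, one_mul]
  have hβ : ‖z / b‖ < 1 := by
    rw [norm_div, hznorm, Complex.norm_real, Real.norm_eq_abs, div_lt_one (abs_pos.2 hb0)]
    exact hb'
  have hκ : ‖z / c‖ < 1 := by
    rw [norm_div, hznorm, Complex.norm_real, Real.norm_eq_abs, div_lt_one (abs_pos.2 hc0)]
    exact hc'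
  have hβ' : ‖-(z / b)‖ < 1 := by rwa [norm_neg]
  have hκ' : ‖-(z / c)‖ < 1 := by rwa [norm_neg]
  have hne : ∀ {s : ℂ}, ‖s‖ < 1 → 1 + s ≠ 0 := fun hs h0 => by
    have := one_add_re_pos hs
    simp [h0] at this
  have hbC : (b : ℂ) ≠ 0 := by exact_mod_cast hb0
  have hcC : (c : ℂ) ≠ 0 := by exact_mod_cast hc0
  have y0 : halfTwist 0 1 ξ t 0 = ((ξ 0 + ξ 1) / 2 : ℂ) + z := by
    simp only [halfTwist, hz, hd]; push_cast; simp; ring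
  have y1 : halfTwist 0 1 ξ t 1 = ((ξ 0 + ξ 1) / 2 : ℂ) - z := by
    simp only [halfTwist, hz, hd]; push_cast; simp; ring
  have y2 : halfTwist 0 1 ξ t 2 = (ξ 2 : ℂ) := by simp [halfTwist]
  have y3 : halfTwist 0 1 ξ t 3 = (ξ 3 : ℂ) := by simp [halfTwist]
  have hbz : (b : ℂ) + z = b * (1 + z / b) := by field_simp
  have hcz : (c : ℂ) - z = c * (1 + -(z / c)) := by field_simp; ring
  have hDen : ratioDen (halfTwist 0 1 ξ t) = (b * c : ℝ) * ((1 + z / b) * (1 + -(z / c))) := by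
    have : ratioDen (halfTwist 0 1 ξ t) = (b + z) * (c - z) := by
      rw [ratioDen, y0, y1, y2, y3, hb, hc]; push_cast; ring
    rw [this, hbz, hcz]; push_cast; ring
  have hsum : ratioDen (halfTwist 0 1 ξ t) - ratioNum (halfTwist 0 1 ξ t) =
      (b * c : ℝ) * ((1 + z / c) * (1 + -(z / b))) := by
    have : ratioDen (halfTwist 0 1 ξ t) - ratioNum (halfTwist 0 1 ξ t) = (c + z) * (b - z) := by
      rw [ratioDen, ratioNum, y0, y1, y2, y3, hb, hc]; push_cast; ring
    rw [this]
    push_cast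
    field_simp
    ring
  -- At the start Q = bc(1 + d/b)(1 - d/c) with the last two factors positive, so bc has the sign of
  -- Q.
  have hεbc : 0 < ε * (b * c) := by
    have h1 : ratioDen ξ = (b * c) * ((1 + d / b) * (1 - d / c)) := by
      rw [ratioDen]
      have e1 : b * (1 + d / b) = ξ 0 - ξ 2 := by field_simp; rw [hb, hd]; ring
      have e2 : c * (1 - d / c) = ξ 1 - ξ 3 := by field_simp; rw [hc, hd]; ring
      rw [← e1, ← e2]; ring
    have h2 : 0 < 1 + d / b := by
      have : |d / b| < 1 := by rw [abs_div, div_lt_one (abs_pos.2 hb0)]; exact hb'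
      linarith [(abs_lt.1 this).1]
    have h3 : 0 < 1 - d / c := by
      have : |d / c| < 1 := by rw [abs_div, div_lt_one (abs_pos.2 hc0)]; exact hc'
      linarith [(abs_lt.1 this).2]
    rw [h1, ← mul_assoc] at hden
    exact (pos_iff_pos_of_mul_pos hden).2 (mul_pos h2 h3)
  constructor
  · have e : (ε : ℂ) * ratioDen (halfTwist 0 1 ξ t) =
        ((ε * (b * c) : ℝ) : ℂ) * (1 + z / b) * (1 + -(z / c)) := by
      rw [hDen]; push_cast; ring
    rw [e]
    refine mul_mem_slitPlane_of_re_pos ?_ (one_add_re_pos hκ')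
    rw [Complex.re_ofReal_mul]
    exact mul_pos hεbc (one_add_re_pos hβ)
  · have hbcC : ((b * c : ℝ) : ℂ) ≠ 0 := by exact_mod_cast mul_ne_zero hb0 hc0
    have hDen0 : ratioDen (halfTwist 0 1 ξ t) ≠ 0 := by
      rw [hDen]; exact mul_ne_zero hbcC (mul_ne_zero (hne hβ) (hne hκ'))
    have e : 1 - ratioNum (halfTwist 0 1 ξ t) / ratioDen (halfTwist 0 1 ξ t) =
        ((1 + z / c) / (1 + -(z / c))) * ((1 + -(z / b)) / (1 + -(-(z / b)))) := by
      rw [one_sub_div hDen0, hsum, hDen, neg_neg, mul_div_mul_left _ _ hbcC,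
        div_mul_div_comm, mul_comm (1 + z / b)]
    rw [e]
    exact mul_mem_slitPlane_of_re_pos (cayley_re_pos hκ) (cayley_re_pos hβ')

theorem analyticAt_twistedBranch (h : IsSeparated ε ξ) (p q r : ℝ) {G : ℂ → ℂ}
    (hG : ∀ x : ℂ, 1 - x ∈ Complex.slitPlane → AnalyticAt ℂ G x) (t : ℝ) :
    AnalyticAt ℂ (twistedBranch ε p q r G t) (halfTwist 0 1 ξ t) := by
  obtain ⟨h1, h2⟩ := path_mem_slitPlane h t
  have hN := analyticAt_ratioNum (halfTwist 0 1 ξ t)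
  have hD := analyticAt_ratioDen (halfTwist 0 1 ξ t)
  have hD0 := right_ne_zero_of_mul (Complex.slitPlane_ne_zero h1)
  have hP : (ε : ℂ) * (Complex.exp (-(Real.pi * t * Complex.I)) *
      ratioNum (halfTwist 0 1 ξ t)) ∈ Complex.slitPlane := by
    rw [num_halfTwist, ← Complex.ofReal_mul]
    exact Complex.ofReal_mem_slitPlane.2 (num_pos_of_mem h.den_pos h.ratio_mem)
  have hx := hN.div hD hD0
  refine AnalyticAt.mul (AnalyticAt.mul (AnalyticAt.mul (analyticAt_const.mul ?_) ?_) ?_) ?_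
  · exact (analyticAt_const.mul (analyticAt_const.mul hN)).cpow analyticAt_const hP
  · exact (analyticAt_const.mul hD).cpow analyticAt_const h1
  · exact (analyticAt_const.sub hx).cpow analyticAt_const h2
  · exact AnalyticAt.fun_comp (hG _ h2) hx

/-- A time step below 1/2 rotates the base of the power by less than π/2, as `rotate_cpow` requires;
the change of branch is then compensated by the explicit exponential. -/
theorem twistedBranch_eventuallyEq (h : IsSeparated ε ξ) (p q r : ℝ) (G : ℂ → ℂ) {s t : ℝ}
    (hst : |s - t| < 1 / 2) :
    twistedBranch ε p q r G s =ᶠ[𝓝 (halfTwist 0 1 ξ s)] twistedBranch ε p q r G t := by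
  have hcont : Continuous fun y : Fin 4 → ℂ =>
      ((ε : ℂ) * (Complex.exp (-(Real.pi * s * Complex.I)) * ratioNum y)).re := by
    unfold ratioNum; fun_prop
  have hev : ∀ᶠ y in 𝓝 (halfTwist 0 1 ξ s),
      0 < ((ε : ℂ) * (Complex.exp (-(Real.pi * s * Complex.I)) * ratioNum y)).re := by
    refine hcont.continuousAt.eventually (lt_mem_nhds ?_)
    beta_reduce
    rw [num_halfTwist, ← Complex.ofReal_mul, Complex.ofReal_re]
    exact num_pos_of_mem h.den_pos h.ratio_mem
  filter_upwards [hev] with y hy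
  have hθ : |Real.pi * (s - t)| < Real.pi / 2 := by
    rw [abs_mul, abs_of_pos Real.pi_pos]
    nlinarith [Real.pi_pos]
  have hrot := rotate_cpow hy hθ (p : ℂ)
  have e1 : Complex.exp (((Real.pi * (s - t) : ℝ) : ℂ) * Complex.I) *
      ((ε : ℂ) * (Complex.exp (-(Real.pi * s * Complex.I)) * ratioNum y)) =
      (ε : ℂ) * (Complex.exp (-(Real.pi * t * Complex.I)) * ratioNum y) := by
    have : Complex.exp (((Real.pi * (s - t) : ℝ) : ℂ) * Complex.I) *
        Complex.exp (-(Real.pi * s * Complex.I)) = Complex.exp (-(Real.pi * t * Complex.I)) := by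
      rw [← Complex.exp_add]; congr 1; push_cast; ring
    rw [← this]; ring
  have e2 : Complex.exp (Real.pi * t * Complex.I * p) *
      Complex.exp (((Real.pi * (s - t) : ℝ) : ℂ) * Complex.I * p) =
      Complex.exp (Real.pi * s * Complex.I * p) := by
    rw [← Complex.exp_add]; congr 1; push_cast; ring
  rw [twistedBranch, twistedBranch, ← e1, hrot, ← e2]
  ring

end path

theorem twistedBranch_zero_ofReal (ε p q r : ℝ) (G : ℂ → ℂ) {y : Fin 4 → ℝ}
    (hd : 0 < ε * ratioDen y) (hx : crossRatio y ∈ Ioo (0 : ℝ) 1) :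
    twistedBranch ε p q r G 0 (fun l => (y l : ℂ)) =
      (((ε * ratioNum y) ^ p : ℝ) : ℂ) * (((ε * ratioDen y) ^ q : ℝ) : ℂ) *
        (((1 - crossRatio y) ^ r : ℝ) : ℂ) * G (crossRatio y) := by
  have hn := num_pos_of_mem hd hx
  rw [Complex.ofReal_cpow hn.le, Complex.ofReal_cpow hd.le,
    Complex.ofReal_cpow (by linarith [hx.2]), twistedBranch, ratioNum_ofReal, ratioDen_ofReal,
    crossRatio_eq]
  simp

/-- The swap sends P to -P, Q to (1-x)Q and 1-x to its inverse. The factor e^(-iπ) undoes the sign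
of P, and the exponent 2r - q in `hpf` is the one for which the powers of 1-x recombine to (1-x)^r.
-/
theorem twistedBranch_one_swap (ε p q r : ℝ) {G : ℂ → ℂ}
    (hpf : ∀ x ∈ Ioo (0 : ℝ) 1,
      G ((x / (x - 1) : ℝ) : ℂ) = (((1 - x) ^ (2 * r - q) : ℝ) : ℂ) * G x) {y : Fin 4 → ℝ}
    (hd : 0 < ε * ratioDen y) (hx : crossRatio y ∈ Ioo (0 : ℝ) 1) :
    twistedBranch ε p q r G 1 (fun l => (y (Equiv.swap 0 1 l) : ℂ)) =
      Complex.exp (Real.pi * Complex.I * p) *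
        twistedBranch ε p q r G 0 (fun l => (y l : ℂ)) := by
  have hn := num_pos_of_mem hd hx
  have hd0 : ratioDen y ≠ 0 := fun h => by simp [h] at hd
  set x := crossRatio y with hxdef
  have hx1 : 0 < 1 - x := by linarith [hx.2]
  have hx2 : x - 1 ≠ 0 := by linarith
  have hnx : ratioNum y = x * ratioDen y := by
    rw [hxdef, crossRatio_eq]; field_simp
  have e0 : Equiv.swap (0 : Fin 4) 1 0 = 1 := by decide
  have e1 : Equiv.swap (0 : Fin 4) 1 1 = 0 := by decide
  have e2 : Equiv.swap (0 : Fin 4) 1 2 = 2 := by decide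
  have e3 : Equiv.swap (0 : Fin 4) 1 3 = 3 := by decide
  have hN : ratioNum (fun l => (y (Equiv.swap 0 1 l) : ℂ)) = ((-ratioNum y : ℝ) : ℂ) := by
    simp only [ratioNum, e0, e1, e2, e3]; push_cast; ring
  have hD : ratioDen (fun l => (y (Equiv.swap 0 1 l) : ℂ)) =
      (((1 - x) * ratioDen y : ℝ) : ℂ) := by
    have : (1 - x) * ratioDen y = (y 1 - y 2) * (y 0 - y 3) := by
      rw [sub_mul, one_mul, ← hnx, ratioNum, ratioDen]; ring
    rw [this]
    simp only [ratioDen, e0, e1, e2, e3]; push_cast; ring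
  have hratio : -ratioNum y / ((1 - x) * ratioDen y) = x / (x - 1) := by
    rw [hnx]; field_simp; ring
  have hexp : Complex.exp (-(Real.pi * ((1 : ℝ) : ℂ) * Complex.I)) = -1 := by
    rw [Complex.ofReal_one, mul_one, Complex.exp_neg, Complex.exp_pi_mul_I]; norm_num
  have hone : 1 - x / (x - 1) = (1 - x)⁻¹ := by
    field_simp; ring
  have hnum : (ε : ℂ) * (-1 * ((-ratioNum y : ℝ) : ℂ)) = ((ε * ratioNum y : ℝ) : ℂ) := by
    push_cast; ring
  have hden : (ε : ℂ) * (((1 - x) * ratioDen y : ℝ) : ℂ) =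
      (((1 - x) * (ε * ratioDen y) : ℝ) : ℂ) := by push_cast; ring
  have hsub : (1 : ℂ) - ((x / (x - 1) : ℝ) : ℂ) = (((1 - x)⁻¹ : ℝ) : ℂ) := by
    rw [← hone]; push_cast; ring
  rw [twistedBranch_zero_ofReal ε p q r G hd hx, ← hxdef, twistedBranch, hN, hD,
    ← Complex.ofReal_div, hratio, hexp, hpf x hx, hnum, hden, hsub,
    ← Complex.ofReal_cpow hn.le, ← Complex.ofReal_cpow (mul_pos hx1 hd).le,
    ← Complex.ofReal_cpow (inv_pos.2 hx1).le, Real.mul_rpow hx1.le hd.le]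
  have hpow : (1 - x) ^ q * (1 - x)⁻¹ ^ r * (1 - x) ^ (2 * r - q) = (1 - x) ^ r := by
    rw [Real.inv_rpow hx1.le, ← Real.rpow_neg hx1.le, ← Real.rpow_add hx1, ← Real.rpow_add hx1]
    congr 1; ring
  rw [← hpow]
  push_cast
  simp only [mul_one]
  ring

theorem exists_continuation {ε : ℝ} {ξ : Fin 4 → ℝ} (h : IsSeparated ε ξ) (N p q r : ℝ)
    {f : (Fin 4 → ℝ) → ℝ} {G : ℂ → ℂ}
    (hG : ∀ x : ℂ, 1 - x ∈ Complex.slitPlane → AnalyticAt ℂ G x)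
    (hpf : ∀ x ∈ Ioo (0 : ℝ) 1,
      G ((x / (x - 1) : ℝ) : ℂ) = (((1 - x) ^ (2 * r - q) : ℝ) : ℂ) * G x)
    (hf : ∀ y, 0 < ε * ratioDen y → crossRatio y ∈ Ioo (0 : ℝ) 1 →
      (f y : ℂ) = N * ((((ε * ratioNum y) ^ p : ℝ) : ℂ) * (((ε * ratioDen y) ^ q : ℝ) : ℂ) *
        (((1 - crossRatio y) ^ r : ℝ) : ℂ) * G (crossRatio y))) :
    ∃ φ : ℝ → (Fin 4 → ℂ) → ℂ, IsContinuation f ξ (halfTwist 0 1 ξ) φ ∧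
      ∀ᶠ y in 𝓝 ξ, φ 1 (fun l => (y (Equiv.swap 0 1 l) : ℂ)) =
        Complex.exp (Real.pi * Complex.I * p) * (f y : ℂ) := by
  have hev := eventually_separated h.den_pos h.ratio_mem
  refine ⟨fun t y => N * twistedBranch ε p q r G t y, ⟨?_, ?_, ?_⟩, ?_⟩
  · filter_upwards [hev] with y hy
    rw [twistedBranch_zero_ofReal ε p q r G hy.1 hy.2, hf y hy.1 hy.2]
  · exact fun t _ => analyticAt_const.mul (analyticAt_twistedBranch h p q r hG t)
  · intro t _
    have : ∀ᶠ s in 𝓝 t, |s - t| < 1 / 2 := Metric.ball_mem_nhds t (by norm_num)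
    filter_upwards [nhdsWithin_le_nhds this] with s hs
    filter_upwards [twistedBranch_eventuallyEq h p q r G hs] with y hy
    rw [hy]
  · filter_upwards [hev] with y hy
    rw [twistedBranch_one_swap ε p q r hpf hy.1 hy.2,
      twistedBranch_zero_ofReal ε p q r G hy.1 hy.2, hf y hy.1 hy.2]
    ring

/-! ### The blocks as branches of P^p Q^q (1-x)^r G(x) -/

/-- This identity makes the powers combine: x^(a/2) x^(1-2a) = x^(-2h_σ) in the first block,
Q^(-2h_σ) = Q^(a/2) Q^(1-2a) in the second. -/
theorem two_mul_hSigma (k : ℕ) : 2 * hSigma k = 3 * (expo k / 2) - 1 := by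
  rw [hSigma, expo]; field_simp; ring

theorem abs_den_eq {ε : ℝ} (hε : |ε| = 1) {y : Fin 4 → ℝ} (hd : 0 < ε * ratioDen y) :
    |(y 0 - y 2) * (y 1 - y 3)| = ε * ratioDen y := by
  rw [← abs_of_pos hd, abs_mul ε, hε, one_mul]
  rfl

theorem num_eq {ε : ℝ} {y : Fin 4 → ℝ} (hd : 0 < ε * ratioDen y) :
    ε * ratioNum y = crossRatio y * (ε * ratioDen y) := by
  have hd0 : ratioDen y ≠ 0 := fun h => by simp [h] at hd
  rw [crossRatio_eq]; field_simp

theorem fullBlock_zero_eq {k : ℕ} {C ε : ℝ} (hε : |ε| = 1) {y : Fin 4 → ℝ}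
    (hd : 0 < ε * ratioDen y) (hx : crossRatio y ∈ Ioo (0 : ℝ) 1) :
    (fullBlock k C 0 y : ℂ) = (√(normConst k C 0) : ℝ) *
      ((((ε * ratioNum y) ^ (-(2 * hSigma k)) : ℝ) : ℂ) *
        (((ε * ratioDen y) ^ (0 : ℝ) : ℝ) : ℂ) *
        (((1 - crossRatio y) ^ (expo k / 2) : ℝ) : ℂ) * euler₁ (expo k) (crossRatio y)) := by
  have hx1 : 0 ≤ 1 - crossRatio y := by linarith [hx.2]
  rw [fullBlock, block, abs_den_eq hε hd, num_eq hd, Real.mul_rpow hx.1.le hd.le,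
    Real.mul_rpow hx.1.le hx1, Real.rpow_zero]
  push_cast
  rw [contourIntegral_zero k hx]
  have : crossRatio y ^ (-(2 * hSigma k)) =
      crossRatio y ^ (expo k / 2) * crossRatio y ^ (1 - 2 * expo k) := by
    rw [← Real.rpow_add hx.1, two_mul_hSigma]; congr 1; ring
  rw [this]
  push_cast
  ring

theorem fullBlock_one_eq {k : ℕ} {C ε : ℝ} (hε : |ε| = 1) {y : Fin 4 → ℝ}
    (hd : 0 < ε * ratioDen y) (hx : crossRatio y ∈ Ioo (0 : ℝ) 1) :
    (fullBlock k C 1 y : ℂ) = (√(normConst k C 1) : ℝ) *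
      ((((ε * ratioNum y) ^ (expo k / 2) : ℝ) : ℂ) *
        (((ε * ratioDen y) ^ (1 - 2 * expo k) : ℝ) : ℂ) *
        (((1 - crossRatio y) ^ (expo k / 2) : ℝ) : ℂ) * euler₂ (expo k) (crossRatio y)) := by
  have hx1 : 0 ≤ 1 - crossRatio y := by linarith [hx.2]
  rw [fullBlock, block, abs_den_eq hε hd, num_eq hd, Real.mul_rpow hx.1.le hd.le,
    Real.mul_rpow hx.1.le hx1]
  push_cast
  rw [contourIntegral_one k hx]
  have : (ε * ratioDen y) ^ (-(2 * hSigma k)) =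
      (ε * ratioDen y) ^ (expo k / 2) * (ε * ratioDen y) ^ (1 - 2 * expo k) := by
    rw [← Real.rpow_add hd, two_mul_hSigma]; congr 1; ring
  rw [this]
  push_cast
  ring

/-- The diagonal entries of `R12`. -/
noncomputable def twistPhase (k : ℕ) (μ : Fin 2) : ℂ := R12 k μ μ

theorem exists_blockContinuation {k : ℕ} (hk : 2 ≤ k) (C : ℝ) {ε : ℝ} (hε : |ε| = 1)
    {ξ : Fin 4 → ℝ} (h : IsSeparated ε ξ) (μ : Fin 2) :
    ∃ φ : ℝ → (Fin 4 → ℂ) → ℂ, IsContinuation (fullBlock k C μ) ξ (halfTwist 0 1 ξ) φ ∧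
      ∀ᶠ y in 𝓝 ξ, φ 1 (fun l => (y (Equiv.swap 0 1 l) : ℂ)) =
        twistPhase k μ * (fullBlock k C μ y : ℂ) := by
  have ha := expo_lt_one k
  have ha' := two_thirds_lt_expo hk
  fin_cases μ
  · have e : twistPhase k 0 = Complex.exp (Real.pi * Complex.I * ((-(2 * hSigma k) : ℝ) : ℂ)) := by
      simp only [twistPhase, R12, Matrix.of_apply, Matrix.cons_val', Matrix.cons_val_zero,
        phase, hSigma, Matrix.cons_val_fin_one]
      congr 1
      push_cast
      have : (k : ℂ) + 2 ≠ 0 := by exact_mod_cast (by positivity : (k : ℝ) + 2 ≠ 0)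
      field_simp
      norm_num
    simp only [Fin.zero_eta, e]
    refine exists_continuation h _ _ 0 (expo k / 2) (G := euler₁ (expo k))
      (fun x hx => analyticAt_euler₁ ha hx) (fun x hx => ?_) fun y hd hx =>
        fullBlock_zero_eq hε hd hx
    rw [euler₁_pfaff _ hx]; ring_nf
  · have e : twistPhase k 1 = Complex.exp (Real.pi * Complex.I * ((expo k / 2 : ℝ) : ℂ)) := by
      simp only [twistPhase, R12, Matrix.of_apply, Matrix.cons_val', Matrix.cons_val_one,
        phase, expo, Matrix.cons_val_fin_one]
      congr 1
      push_cast
      have : (k : ℂ) + 2 ≠ 0 := by exact_mod_cast (by positivity : (k : ℝ) + 2 ≠ 0)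
      field_simp
    simp only [Fin.mk_one, e]
    refine exists_continuation h _ _ (1 - 2 * expo k) (expo k / 2) (G := euler₂ (expo k))
      (fun x hx => analyticAt_euler₂ ha (by linarith) hx) (fun x hx => ?_) fun y hd hx =>
        fullBlock_one_eq hε hd hx
    rw [euler₂_pfaff _ hx]; ring_nf

/-! ### The braiding matrices -/

theorem R12_eq_diagonal (k : ℕ) (μ ν : Fin 2) :
    R12 k μ ν = if μ = ν then twistPhase k μ else 0 := by
  fin_cases μ <;> fin_cases ν <;> simp [R12, twistPhase]

theorem strictMono_lt {η : Fin 4 → ℝ} (hη : StrictMono η) : η 0 < η 1 ∧ η 1 < η 2 ∧ η 2 < η 3 :=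
  ⟨hη (by decide), hη (by decide), hη (by decide)⟩

theorem isSeparated_of_strictMono {η : Fin 4 → ℝ} (hη : StrictMono η) : IsSeparated 1 η := by
  obtain ⟨h01, h12, h23⟩ := strictMono_lt hη
  refine ⟨?_, crossRatio_mem hη, ?_, ?_⟩
  · rw [one_mul]; exact mul_pos_of_neg_of_neg (by linarith) (by linarith)
  all_goals
    rw [abs_of_neg (by linarith), abs_of_neg (by linarith)]
    linarith

/-- Relabelling the first and third positions reverses the signs of numerator and denominator,
whence ε = -1. -/
theorem isSeparated_swap {η : Fin 4 → ℝ} (hη : StrictMono η) :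
    IsSeparated (-1) (fun l => η (Equiv.swap 0 2 l)) := by
  obtain ⟨h01, h12, h23⟩ := strictMono_lt hη
  have e0 : Equiv.swap (0 : Fin 4) 2 0 = 2 := by decide
  have e1 : Equiv.swap (0 : Fin 4) 2 1 = 1 := by decide
  have e2 : Equiv.swap (0 : Fin 4) 2 2 = 0 := by decide
  have e3 : Equiv.swap (0 : Fin 4) 2 3 = 3 := by decide
  refine ⟨?_, ?_, ?_, ?_⟩
  · simp only [ratioDen, e0, e1, e2, e3]
    nlinarith [mul_pos (show 0 < η 2 - η 0 by linarith) (show 0 < η 3 - η 1 by linarith)]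
  · rw [crossRatio_swap (by linarith : η 0 < η 2).ne (by linarith : η 1 < η 3).ne]
    exact one_sub_mem_Ioo (crossRatio_mem hη)
  · simp only [e0, e1, e2]
    rw [abs_of_pos (by linarith), abs_of_pos (by linarith)]
    linarith
  · simp only [e0, e1, e3]
    rw [abs_of_pos (by linarith), abs_of_neg (by linarith)]
    linarith

theorem isBraidingMatrix_R12 {k : ℕ} (hk : 2 ≤ k) (C : ℝ) : IsBraidingMatrix k C 0 1 (R12 k) := by
  intro η hη μ
  obtain ⟨φ, hφ, h1⟩ := exists_blockContinuation hk C abs_one (isSeparated_of_strictMono hη) μ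
  refine ⟨φ, hφ, h1.mono fun y hy => ?_⟩
  rw [hy]
  simp [R12_eq_diagonal]

/-- Linear combinations and relabelling of coordinates preserve continuation; this transports the
half-turn of the first pair to the second pair. -/
theorem IsContinuation.sum_smul_comp {ι : Type*} [Fintype ι] (σ : Equiv.Perm (Fin 4))
    {f : (Fin 4 → ℝ) → ℝ} {g : ι → (Fin 4 → ℝ) → ℝ} {c : ι → ℂ} {η : Fin 4 → ℝ}
    {γ : ℝ → Fin 4 → ℂ} {φ : ι → ℝ → (Fin 4 → ℂ) → ℂ}
    (hφ : ∀ ν, IsContinuation (g ν) (fun l => η (σ l)) (fun t l => γ t (σ l)) (φ ν))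
    (hf : ∀ᶠ y in 𝓝 η, (f y : ℂ) = ∑ ν, c ν * (g ν (fun l => y (σ l)) : ℂ)) :
    IsContinuation f η γ (fun t y => ∑ ν, c ν * φ ν t (fun l => y (σ l))) := by
  have hR : Continuous fun y : Fin 4 → ℝ => fun l => y (σ l) := by fun_prop
  have hC : Continuous fun y : Fin 4 → ℂ => fun l => y (σ l) := by fun_prop
  refine ⟨?_, fun t ht => ?_, fun t ht => ?_⟩
  · have h := fun ν => hR.continuousAt.eventually (hφ ν).start
    filter_upwards [hf, eventually_all.2 h] with y hy hy'
    rw [hy]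
    exact Finset.sum_congr rfl fun ν _ => congrArg (c ν * ·) (hy' ν)
  · refine Finset.analyticAt_fun_sum _ fun ν _ => analyticAt_const.mul ?_
    have hlin : AnalyticAt ℂ (fun y : Fin 4 → ℂ => fun l => y (σ l)) (γ t) :=
      (ContinuousLinearMap.pi fun l =>
        ContinuousLinearMap.proj (R := ℂ) (φ := fun _ : Fin 4 => ℂ) (σ l)).analyticAt _
    exact AnalyticAt.fun_comp ((hφ ν).analytic t ht) hlin
  · have h := fun ν => (hφ ν).compatible t ht
    filter_upwards [eventually_all.2 h] with s hs
    have hs' := fun ν => (hC.continuousAt (x := γ s)).eventually (hs ν)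
    filter_upwards [eventually_all.2 hs'] with y hy
    exact Finset.sum_congr rfl fun ν _ => congrArg (c ν * ·) (hy ν)

theorem halfTwist_swap (η : Fin 4 → ℝ) (t : ℝ) :
    halfTwist 0 1 (fun l => η (Equiv.swap 0 2 l)) t =
      fun l => halfTwist 1 2 η t (Equiv.swap 0 2 l) := by
  have e0 : Equiv.swap (0 : Fin 4) 2 0 = 2 := by decide
  have e1 : Equiv.swap (0 : Fin 4) 2 1 = 1 := by decide
  have e2 : Equiv.swap (0 : Fin 4) 2 2 = 0 := by decide
  have e3 : Equiv.swap (0 : Fin 4) 2 3 = 3 := by decide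
  funext l
  fin_cases l <;> simp [halfTwist, e0, e1, e2, e3, add_comm]

theorem R13C_mul_self (k : ℕ) : R13C k * R13C k = 1 := by
  have h := congrArg (Matrix.map · Complex.ofRealHom) (R13_mul_self k)
  simp only [Matrix.map_mul] at h
  rw [Matrix.map_one _ (map_zero _) (map_one _)] at h
  exact h

theorem isBraidingMatrix_conj {k : ℕ} (hk : 2 ≤ k) {C : ℝ} (hC : 0 < C) :
    IsBraidingMatrix k C 1 2 (R13C k * R12 k * R13C k) := by
  intro η hη μ
  have hsep := isSeparated_swap hη
  choose φ hφ h1 using exists_blockContinuation hk C (ε := -1) (by simp) hsep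
  have hR : Continuous fun y : Fin 4 → ℝ => fun l => y (Equiv.swap 0 2 l) := by fun_prop
  have hη1 := isSeparated_of_strictMono hη
  have hev := eventually_separated hη1.den_pos hη1.ratio_mem
  have hswap : ∀ᶠ y in 𝓝 η, ∀ ν, (fullBlock k C ν (fun l => y (Equiv.swap 0 2 l)) : ℂ) =
      ∑ ρ, R13C k ν ρ * (fullBlock k C ρ y : ℂ) := by
    filter_upwards [hev] with y hy ν
    have h02 : y 0 ≠ y 2 := fun h => by simp [ratioDen, h] at hy
    have h13 : y 1 ≠ y 3 := fun h => by simp [ratioDen, h] at hy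
    rw [fullBlock_swap hk hC h02 h13 hy.2]
    push_cast
    rfl
  refine ⟨_, IsContinuation.sum_smul_comp (Equiv.swap 0 2) (c := R13C k μ)
    (g := fullBlock k C) (φ := φ) (fun ν => ?_) ?_, ?_⟩
  · have := hφ ν
    rwa [show halfTwist 0 1 (fun l => η (Equiv.swap 0 2 l)) =
      fun t l => halfTwist 1 2 η t (Equiv.swap 0 2 l) from funext (halfTwist_swap η)] at this
  -- Since `R13C` squares to 1, the block at `y` is the `R13C`-combination of the blocks at the
  -- relabelled point.
  · filter_upwards [hswap] with y hy
    have h := congrFun (congrArg (Matrix.mulVec · fun ρ => (fullBlock k C ρ y : ℂ))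
      (R13C_mul_self k)) μ
    simp only [Matrix.one_mulVec, ← Matrix.mulVec_mulVec] at h
    rw [← h]
    simp only [Matrix.mulVec, dotProduct, hy]
  · have h := fun ν => hR.continuousAt.eventually (h1 ν)
    filter_upwards [hswap, eventually_all.2 h] with y hy hy'
    -- The relation (1 2)(0 2) = (0 2)(0 1) identifies the endpoint with that of the half-turn of
    -- positions 0 and 1 at the relabelled point.
    have hperm : ∀ l : Fin 4, Equiv.swap (1 : Fin 4) 2 (Equiv.swap 0 2 l) =
        Equiv.swap 0 2 (Equiv.swap 0 1 l) := by decide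
    simp only [hperm, hy', hy]
    have e : ∀ ν, twistPhase k ν * ∑ ρ, R13C k ν ρ * (fullBlock k C ρ y : ℂ) =
        (R12 k).mulVec ((R13C k).mulVec fun ρ => (fullBlock k C ρ y : ℂ)) ν := fun ν => by
      simp [Matrix.mulVec, dotProduct, R12_eq_diagonal]
    simp only [e]
    have h' := congrFun (Matrix.mulVec_mulVec (fun ρ => (fullBlock k C ρ y : ℂ))
      (R13C k) (R12 k * R13C k)) μ
    rw [← Matrix.mulVec_mulVec, ← Matrix.mul_assoc] at h'
    exact h'

/-! ### The explicit form of `R23` and the case k = 3 -/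

theorem phase_add (α β : ℝ) : phase (α + β) = phase α * phase β := by
  rw [phase, phase, phase, ← Complex.exp_add]; congr 1; push_cast; ring

theorem phase_pi_div_two : phase (Real.pi / 2) = Complex.I := by
  rw [phase]
  convert Complex.exp_pi_div_two_mul_I using 2
  push_cast; ring

/-- With u = e^(iα/2) and v = u⁻¹, every phase is ±i times a power of u or v. The entries then agree
modulo uv = 1, sin² θ = 1 - cos² θ and cos θ (u² + v²) = 1, the last being 2 cos θ cos α = 1. -/
theorem R23_eq {k : ℕ} (hk : 2 ≤ k) : R23 k = R13C k * R12 k * R13C k := by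
  set u : ℂ := phase (baseAngle k / 2) with hu
  set v : ℂ := phase (-(baseAngle k / 2)) with hv
  have huv : u * v = 1 := by
    rw [hu, hv, ← phase_add, add_neg_cancel]; simp [phase]
  have hu3 : ∀ n : ℕ, phase (n * (baseAngle k / 2)) = u ^ n := fun n => by
    rw [hu, phase, phase, ← Complex.exp_nat_mul]; congr 1; push_cast; ring
  have hv3 : ∀ n : ℕ, phase (-(n * (baseAngle k / 2))) = v ^ n := fun n => by
    rw [hv, phase, phase, ← Complex.exp_nat_mul]; congr 1; push_cast; ring
  have hI : phase (-(Real.pi / 2)) = -Complex.I := by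
    have h : phase (-(Real.pi / 2)) * phase (Real.pi / 2) = 1 := by
      rw [← phase_add, neg_add_cancel]; simp [phase]
    rw [phase_pi_div_two] at h
    linear_combination -Complex.I * h - phase (-(Real.pi / 2)) * Complex.I_mul_I * (-1)
  have hk0 : (k : ℝ) + 2 ≠ 0 := by positivity
  have p1 : phase (-(Real.pi * (((k : ℝ) - 1) / (2 * ((k : ℝ) + 2))))) = -Complex.I * u ^ 3 := by
    rw [← hI, ← hu3, ← phase_add]; congr 1; rw [baseAngle]; push_cast; field_simp; ring
  have p2 : phase (Real.pi * (((k : ℝ) - 1) / (2 * ((k : ℝ) + 2)))) = Complex.I * v ^ 3 := by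
    rw [← phase_pi_div_two, ← hv3, ← phase_add]; congr 1; rw [baseAngle]; push_cast
    field_simp; ring
  have p3 : phase (Real.pi * (((k : ℝ) + 1) / (2 * ((k : ℝ) + 2)))) = Complex.I * v := by
    rw [← phase_pi_div_two, hv, ← phase_add]; congr 1; rw [baseAngle]
    field_simp; ring
  have p4 : phase (-(Real.pi * (((k : ℝ) + 1) / (2 * ((k : ℝ) + 2))))) = -Complex.I * u := by
    rw [← hI, hu, ← phase_add]; congr 1; rw [baseAngle]
    field_simp; ring
  have p5 : phase (-(Real.pi * ((3 * (k : ℝ) + 1) / (2 * ((k : ℝ) + 2))))) =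
      Complex.I * u ^ 5 := by
    have h3 : Complex.I = phase (-(Real.pi / 2)) * phase (-(Real.pi / 2)) * phase (-(Real.pi / 2)) := by
      rw [hI]; linear_combination Complex.I * Complex.I_mul_I
    rw [h3, ← hu3, ← phase_add, ← phase_add, ← phase_add]; congr 1; rw [baseAngle]; push_cast
    field_simp; ring
  have hcos : u ^ 2 + v ^ 2 = 2 * (Real.cos (baseAngle k) : ℂ) := by
    rw [← hu3, ← hv3, phase, phase, Complex.ofReal_cos, Complex.two_cos]
    congr 1 <;> · congr 1; push_cast; ring
  have hc : (Real.cos (theta k) : ℂ) * (u ^ 2 + v ^ 2) = 1 := by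
    have h0 : Real.cos (baseAngle k) ≠ 0 := by linarith [half_lt_cos_baseAngle hk]
    have h1 : Real.cos (theta k) * (2 * Real.cos (baseAngle k)) = 1 := by
      rw [cos_theta hk]
      change 1 / 2 * (Real.cos (baseAngle k))⁻¹ * _ = 1
      field_simp
    rw [hcos]
    exact_mod_cast h1
  have hs : (Real.sin (theta k) : ℂ) ^ 2 = 1 - (Real.cos (theta k) : ℂ) ^ 2 := by
    exact_mod_cast Real.sin_sq (theta k)
  simp only [R23, R12, R13C, R13, p1, p2, p3, p4, p5]
  set c : ℂ := (Real.cos (theta k) : ℂ)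
  set s : ℂ := (Real.sin (theta k) : ℂ)
  ext i j
  fin_cases i <;> fin_cases j <;>
    simp only [Matrix.mul_apply, Fin.sum_univ_two, Matrix.map_apply, Matrix.of_apply,
      Matrix.cons_val', Matrix.cons_val_zero, Matrix.cons_val_one, Matrix.cons_val_fin_one,
      Fin.zero_eta, Fin.mk_one, Complex.ofReal_neg]
  · linear_combination Complex.I * (v * hc - c * u * huv + c * u * hc - c ^ 2 * v * huv) -
      Complex.I * v * hs
  · linear_combination Complex.I * s * (u * hc - c * v * huv)
  · linear_combination Complex.I * s * (u * hc - c * v * huv)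
  · linear_combination Complex.I * u ^ 3 * hs + Complex.I * (-u ^ 3 * hc +
      c * u * (u * v + 1) * huv - c * (u * hc - c * v * huv))

theorem R12_three : R12 3 = !![phase (-(Real.pi / 5)), 0; 0, phase (2 * Real.pi / 5)] := by
  have e1 : -(Real.pi * ((((3 : ℕ) : ℝ) - 1) / (2 * (((3 : ℕ) : ℝ) + 2)))) = -(Real.pi / 5) := by
    push_cast; ring
  have e2 : Real.pi * ((((3 : ℕ) : ℝ) + 1) / (2 * (((3 : ℕ) : ℝ) + 2))) = 2 * Real.pi / 5 := by
    push_cast; ring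
  rw [R12, e1, e2]

theorem cos_theta_three : Real.cos (theta 3) = 1 / Real.goldenRatio := by
  rw [cos_theta (by norm_num)]
  have e : Real.pi / (((3 : ℕ) : ℝ) + 2) = Real.pi / 5 := by push_cast; ring
  rw [e, Real.cos_pi_div_five, Real.goldenRatio]
  field_simp
  norm_num

/-- For the golden ratio γ, γ² = γ + 1 gives 1 - γ⁻² = γ⁻¹. -/
theorem sin_theta_three : Real.sin (theta 3) = 1 / √Real.goldenRatio := by
  have hg := Real.goldenRatio_pos
  have h : (1 / √Real.goldenRatio) ^ 2 = 1 / Real.goldenRatio := by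
    rw [div_pow, Real.sq_sqrt hg.le, one_pow]
  rw [← sq_eq_sq₀ (sin_theta_pos (by norm_num)).le (by positivity), h, Real.sin_sq,
    cos_theta_three]
  have h1 := Real.goldenRatio_sq
  set g := Real.goldenRatio
  field_simp
  linarith

theorem R13_three : R13 3 = !![1 / Real.goldenRatio, 1 / √Real.goldenRatio;
    1 / √Real.goldenRatio, -(1 / Real.goldenRatio)] := by
  rw [R13, cos_theta_three, sin_theta_three]

end CoulombGas

theorem mainTheorem2 (k : ℕ) (hk : 2 ≤ k) (C : ℝ) (hC : 0 < C) :
    -- the integrals that define the two blocks converge, and the blocks are independent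
    (∀ x ∈ Set.Ioo (0 : ℝ) 1,
      MeasureTheory.IntegrableOn (CoulombGas.integrand₁ k x) (Set.Ioo 0 x) ∧
      MeasureTheory.IntegrableOn (CoulombGas.integrand₂ k x) (Set.Ioi 1)) ∧
    LinearIndependent ℂ
      (fun (μ : Fin 2) (x : Set.Ioo (0 : ℝ) 1) => (CoulombGas.block k C μ x : ℂ)) ∧
    -- the angle
    CoulombGas.theta k ∈ Set.Ioo 0 (Real.pi / 2) ∧
    Real.cos (CoulombGas.theta k) = 1 / 2 * (Real.cos (Real.pi / ((k : ℝ) + 2)))⁻¹ ∧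
    -- the exchange of the first and the third position
    (CoulombGas.R13 k).IsSymm ∧
    CoulombGas.R13 k * CoulombGas.R13 k = 1 ∧
    (∀ x ∈ Set.Ioo (0 : ℝ) 1, ∀ μ : Fin 2,
      CoulombGas.block k C μ (1 - x) = ∑ ν, CoulombGas.R13 k μ ν * CoulombGas.block k C ν x) ∧
    (∀ η : Fin 4 → ℝ, StrictMono η → ∀ μ : Fin 2,
      CoulombGas.fullBlock k C μ (fun l => η (Equiv.swap 0 2 l)) =
        ∑ ν, CoulombGas.R13 k μ ν * CoulombGas.fullBlock k C ν η) ∧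
    -- the two braidings
    CoulombGas.IsBraidingMatrix k C 0 1 (CoulombGas.R12 k) ∧
    CoulombGas.IsBraidingMatrix k C 1 2 (CoulombGas.R23 k) ∧
    CoulombGas.R23 k = CoulombGas.R13C k * CoulombGas.R12 k * (CoulombGas.R13C k)⁻¹ ∧
    -- the case of three: the Fibonacci matrices
    CoulombGas.R12 3 =
      !![CoulombGas.phase (-(Real.pi / 5)), 0; 0, CoulombGas.phase (2 * Real.pi / 5)] ∧
    CoulombGas.R13 3 =
      !![1 / Real.goldenRatio, 1 / √Real.goldenRatio;
         1 / √Real.goldenRatio, -(1 / Real.goldenRatio)] :=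
  have hinv : (CoulombGas.R13C k)⁻¹ = CoulombGas.R13C k :=
    Matrix.inv_eq_right_inv (CoulombGas.R13C_mul_self k)
  ⟨fun _ hx => ⟨CoulombGas.integrableOn_integrand₁ hk hx, CoulombGas.integrableOn_integrand₂ hk hx⟩,
    CoulombGas.linearIndependent_block hk hC, CoulombGas.theta_mem hk, CoulombGas.cos_theta hk,
    CoulombGas.R13_isSymm k, CoulombGas.R13_mul_self k,
    fun _ hx μ => CoulombGas.block_one_sub hk hC hx μ,
    fun η hη μ => CoulombGas.fullBlock_swap hk hC (hη (by decide)).ne (hη (by decide)).ne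
      (CoulombGas.crossRatio_mem hη) μ,
    CoulombGas.isBraidingMatrix_R12 hk C,
    (CoulombGas.R23_eq hk).symm ▸ CoulombGas.isBraidingMatrix_conj hk hC,
    by rw [hinv]; exact CoulombGas.R23_eq hk, CoulombGas.R12_three, CoulombGas.R13_three⟩
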